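/- Let $(\mathscr{C},\mathbb{E},\mathfrak{s})$ be a (skeletally small) weakly idempotent complete extriangulated category with enough $\mathbb{E}$-injectives, i.e. every object $A$ admits an $\mathfrak{s}$-conflation $A\to I\to S$ with $I$ in the full subcategory $\mathcal{I}$ of $\mathbb{E}$-injective objects (those $I$ with $\mathbb{E}(-,I)=0$). Let $\mathscr{N}\supseteq\mathcal{I}$ be a full subcategory which is extension-closed (additive, closed under isomorphisms and under middle terms of $\mathfrak{s}$-conflations), closed under direct summands, and closed under cones of $\mathfrak{s}$-inflations (if $A\to B\to C$ is an $\mathfrak{s}$-conflation with $A,B\in\mathscr{N}$, then $C\in\mathscr{N}$). Let $\mathsf{Seq}$ be the class of $\mathfrak{s}$-conflations, $\mathsf{V}$ the class of isomorphisms of $\mathscr{C}$, $\mathcal{K}_{\mathscr{N}}$ the class of $\mathfrak{s}$-inflations with cone in $\mathscr{N}$, $\mathcal{Q}_{\mathcal{I}}$ the class of $\mathfrak{s}$-deflations with cocone in $\mathcal{I}$, and $\mathsf{W}=\mathcal{Q}_{\mathcal{I}}\circ\mathcal{K}_{\mathscr{N}}$ the class of composites $qk$ with $k\in\mathcal{K}_{\mathscr{N}}$,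 $q\in\mathcal{Q}_{\mathcal{I}}$. A weak Waldhausen category is an additive category with a class $\mathsf{Seq}$ of distinguished sequences $A\xrightarrow{f}B\xrightarrow{g}C$ and a class $\mathsf{W}$ of weak equivalences such that, calling first morphisms of distinguished sequences cofibrations: (WC0) cofibrations are closed under composition and contain the isomorphisms; (WC1) $\mathsf{Seq}$ contains the split exact sequences, is closed under isomorphism, and in each distinguished sequence $g$ is a weak cokernel of $f$; (WC2) if $f\colon A\to B$ is a cofibration and $c\colon A\to C$ any morphism, then $\binom{f}{-c}\colon A\to B\oplus C$ is a cofibration, and whenever $A\xrightarrow{\binom{f}{-c}}B\oplus C\xrightarrow{(b,\,g)}D$ is distinguished, $g$ is a cofibration; (WW0) $\mathsf{W}$ is closed under composition and contains the isomorphisms; (WW1) given cofibrations $f_i\colon A_i\to B_i$, morphisms $c_i\colon A_i\to C_i$, distinguished sequences $A_i\xrightarrow{\binom{f_i}{-c_i}}B_i\oplus C_i\xrightarrow{p_i}D_i$ $(i=1,2)$, and weak equivalences $x\colon A_1\to A_2$, $y\colon B_1\to B_2$, $z\colon C_1\to C_2$ with $yf_1=f_2x$ and $zc_1=c_2x$,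 there is a weak equivalence $w\colon D_1\to D_2$ with $wp_1=p_2(y\oplus z)$. Exact functors are the additive functors preserving distinguished sequences and weak equivalences. The full subcategory $\mathscr{C}^{\mathsf{W}}$ consists of the objects $X$ with $0\to X$ in $\mathsf{W}$; $\mathsf{Seq}^{\mathsf{W}}$, $\mathsf{V}^{\mathsf{W}}$ are the restrictions of $\mathsf{Seq}$, $\mathsf{V}$ to it. $K_0(\mathscr{C},\mathsf{Seq},\mathsf{W})$ is the split Grothendieck group modulo $[A]=[B]$ for each weak equivalence $A\to B$ and $[B]=[A]+[C]$ for each distinguished sequence $A\to B\to C$; $K_0(\mathscr{C},\mathbb{E},\mathfrak{s})$ is the split Grothendieck group modulo $[A]-[B]+[C]=0$ for each $\mathfrak{s}$-conflation $A\to B\to C$. Then $(\mathscr{C},\mathsf{Seq},\mathsf{W})$ is a weak Waldhausen category, $\mathscr{C}^{\mathsf{W}}=\mathscr{N}$, the restriction $(\mathscr{N},\mathbb{E}|_{\mathscr{N}},\mathfrak{s}|_{\mathscr{N}})$ is an extriangulated category, and $$(\mathscr{C}^{\mathsf{W}},\mathsf{Seq}^{\mathsf{W}},\mathsf{V}^{\mathsf{W}})\xrightarrow{\mathsf{inc}}(\mathscr{C},\mathsf{Seq},\mathsf{V})\xrightarrow{\mathsf{id}_{\mathscr{C}}}(\mathscr{C},\mathsf{Seq},\mathsf{W})$$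 is a sequence of weak Waldhausen categories and exact functors. It is a localization sequence: for every weak Waldhausen category $(\mathscr{C}',\mathsf{Seq}',\mathsf{W}')$ such that $\mathsf{W}'$ has the 2-out-of-3 property and the extension axiom holds (in a morphism of distinguished sequences whose outer components are in $\mathsf{W}'$, the middle component is in $\mathsf{W}'$), every exact functor $F\colon(\mathscr{C},\mathsf{Seq},\mathsf{V})\to(\mathscr{C}',\mathsf{Seq}',\mathsf{W}')$ with $F(\mathscr{C}^{\mathsf{W}})\subseteq(\mathscr{C}')^{\mathsf{W}'}$ is an exact functor $(\mathscr{C},\mathsf{Seq},\mathsf{W})\to(\mathscr{C}',\mathsf{Seq}',\mathsf{W}')$. Moreover it induces an exact sequence $$K_0(\mathscr{C}^{\mathsf{W}},\mathsf{Seq}^{\mathsf{W}},\mathsf{V}^{\mathsf{W}})\xrightarrow{K_0(\mathsf{inc})}K_0(\mathscr{C},\mathsf{Seq},\mathsf{V})\xrightarrow{K_0(\mathsf{id}_{\mathscr{C}})}K_0(\mathscr{C},\mathsf{Seq},\mathsf{W})\to 0,$$ equivalently, under the identification $K_0(\mathscr{C},\mathbb{E},\mathfrak{s})=K_0(\mathscr{C},\mathsf{Seq},\mathsf{V})$,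 an exact sequence $$K_0(\mathscr{N},\mathbb{E}|_{\mathscr{N}},\mathfrak{s}|_{\mathscr{N}})\to K_0(\mathscr{C},\mathbb{E},\mathfrak{s})\to K_0(\mathscr{C},\mathsf{Seq},\mathsf{W})\to 0.$$ -/

import Mathlib

open CategoryTheory CategoryTheory.Limits Opposite

universe u v w u' v'

/-! ## Extriangulated categories -/

/-- The value at `(X, A)` of a bifunctor `E : Cᵒᵖ × C → Ab`. -/
abbrev BiExt {C : Type u} [Category.{v} C] (E : Cᵒᵖ ⥤ C ⥤ AddCommGrpCat.{w}) (X A : C) : Type w :=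
  (E.obj (op X)).obj A

/-- `a_* δ = E(X, a)(δ)`. -/
def BiExt.push {C : Type u} [Category.{v} C] {E : Cᵒᵖ ⥤ C ⥤ AddCommGrpCat.{w}} {X A A' : C}
    (a : A ⟶ A') (δ : BiExt E X A) : BiExt E X A' :=
  ((E.obj (op X)).map a).hom δ

/-- `c^* δ = E(c, A)(δ)`. -/
def BiExt.pull {C : Type u} [Category.{v} C] {E : Cᵒᵖ ⥤ C ⥤ AddCommGrpCat.{w}} {X X' A : C}
    (c : X' ⟶ X) (δ : BiExt E X A) : BiExt E X' A :=
  ((E.map c.op).app A).hom δ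

/-- The direct sum of two morphisms, with respect to given direct sums of sources and targets. -/
def bisum {C : Type u} [Category.{v} C] [Preadditive C] {A A' B B' : C}
    (P : BinaryBicone A A') (Q : BinaryBicone B B') (f : A ⟶ B) (f' : A' ⟶ B') : P.pt ⟶ Q.pt :=
  P.fst ≫ f ≫ Q.inl + P.snd ≫ f' ≫ Q.inr

/-- The data `(E, s)` on a category `C` : a bifunctor `E`, together with the relation
`Tri f g δ`, read "`A --f--> B --g--> X` belongs to the class `s(δ)`".  The axioms, among them
that the `(f, g)` with `Tri f g δ` form exactly one equivalence class, are in
`ExtriData.IsExtriangulated`. -/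
structure ExtriData (C : Type u) [Category.{v} C] where
  E : Cᵒᵖ ⥤ C ⥤ AddCommGrpCat.{w}
  Tri : ∀ ⦃A B X : C⦄, (A ⟶ B) → (B ⟶ X) → BiExt E X A → Prop

/-- `(C, E, s)` is an extriangulated category in the sense of Nakaoka and Palu. -/
structure ExtriData.IsExtriangulated {C : Type u} [Category.{v} C] [Preadditive C]
    (D : ExtriData.{u, v, w} C) : Prop where
  /-- `C` is an additive category. -/
  additive : HasFiniteBiproducts C
  /-- (ET1): `E` is biadditive. -/
  additive_left : D.E.Additive
  additive_right : ∀ X : Cᵒᵖ, (D.E.obj X).Additive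
  /-- `s(δ)` is an equivalence class of sequences: it is not empty ... -/
  exists_tri : ∀ {X A : C} (δ : BiExt D.E X A), ∃ (B : C) (f : A ⟶ B) (g : B ⟶ X), D.Tri f g δ
  /-- ... and consists of all sequences equivalent to a given member. -/
  tri_iff : ∀ {A B B' X : C} {δ : BiExt D.E X A} {f : A ⟶ B} {g : B ⟶ X}
    (f' : A ⟶ B') (g' : B' ⟶ X), D.Tri f g δ →
    (D.Tri f' g' δ ↔ ∃ b : B ≅ B', f ≫ b.hom = f' ∧ b.hom ≫ g' = g)
  /-- (ET2): `s` is a realization ... -/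
  realize : ∀ {A B X A' B' X' : C} {f : A ⟶ B} {g : B ⟶ X} {δ : BiExt D.E X A}
    {f' : A' ⟶ B'} {g' : B' ⟶ X'} {δ' : BiExt D.E X' A'} (a : A ⟶ A') (c : X ⟶ X'),
    D.Tri f g δ → D.Tri f' g' δ' → δ.push a = δ'.pull c →
    ∃ b : B ⟶ B', f ≫ b = a ≫ f' ∧ g ≫ c = b ≫ g'
  /-- ... which sends the zero extension to the split sequence ... -/
  tri_zero : ∀ {A X : C} (P : BinaryBicone A X), P.IsBilimit → D.Tri P.inl P.snd 0
  /-- ... and is compatible with direct sums. -/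
  tri_sum : ∀ {A B X A' B' X' : C} {f : A ⟶ B} {g : B ⟶ X} {δ : BiExt D.E X A}
    {f' : A' ⟶ B'} {g' : B' ⟶ X'} {δ' : BiExt D.E X' A'}
    (P : BinaryBicone A A') (Q : BinaryBicone B B') (R : BinaryBicone X X'),
    P.IsBilimit → Q.IsBilimit → R.IsBilimit → D.Tri f g δ → D.Tri f' g' δ' →
    D.Tri (bisum P Q f f') (bisum Q R g g')
      ((δ.pull R.fst).push P.inl + (δ'.pull R.snd).push P.inr)
  /-- (ET3) -/
  et3 : ∀ {A B X A' B' X' : C} {f : A ⟶ B} {g : B ⟶ X} {δ : BiExt D.E X A}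
    {f' : A' ⟶ B'} {g' : B' ⟶ X'} {δ' : BiExt D.E X' A'} (a : A ⟶ A') (b : B ⟶ B'),
    D.Tri f g δ → D.Tri f' g' δ' → f ≫ b = a ≫ f' →
    ∃ c : X ⟶ X', g ≫ c = b ≫ g' ∧ δ.push a = δ'.pull c
  /-- (ET3)ᵒᵖ -/
  et3_op : ∀ {A B X A' B' X' : C} {f : A ⟶ B} {g : B ⟶ X} {δ : BiExt D.E X A}
    {f' : A' ⟶ B'} {g' : B' ⟶ X'} {δ' : BiExt D.E X' A'} (b : B ⟶ B') (c : X ⟶ X'),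
    D.Tri f g δ → D.Tri f' g' δ' → g ≫ c = b ≫ g' →
    ∃ a : A ⟶ A', f ≫ b = a ≫ f' ∧ δ.push a = δ'.pull c
  /-- (ET4) -/
  et4 : ∀ {A B X Y Z : C} {f : A ⟶ B} {f' : B ⟶ X} {δ : BiExt D.E X A}
    {g : B ⟶ Y} {g' : Y ⟶ Z} {ρ : BiExt D.E Z B}, D.Tri f f' δ → D.Tri g g' ρ →
    ∃ (W : C) (h' : Y ⟶ W) (d : X ⟶ W) (e : W ⟶ Z) (δ' : BiExt D.E W A),
      D.Tri (f ≫ g) h' δ' ∧ D.Tri d e (ρ.push f') ∧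
      f' ≫ d = g ≫ h' ∧ h' ≫ e = g' ∧ δ'.pull d = δ ∧ δ'.push f = ρ.pull e
  /-- (ET4)ᵒᵖ -/
  et4_op : ∀ {A B X Y Z : C} {f' : X ⟶ A} {f : A ⟶ B} {δ : BiExt D.E B X}
    {g' : Z ⟶ B} {g : B ⟶ Y} {ρ : BiExt D.E Y Z}, D.Tri f' f δ → D.Tri g' g ρ →
    ∃ (W : C) (d : X ⟶ W) (e : W ⟶ Z) (h' : W ⟶ A) (δ' : BiExt D.E Y W),
      D.Tri h' (f ≫ g) δ' ∧ D.Tri d e (δ.pull g') ∧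
      d ≫ h' = f' ∧ h' ≫ f = e ≫ g' ∧ δ'.push e = ρ ∧ δ.push d = δ'.pull g

/-- A class of composable pairs `A ⟶ B ⟶ X` of morphisms. -/
abbrev SeqClass (C : Type u) [Category.{v} C] : Type (max u v) :=
  ∀ ⦃A B X : C⦄, (A ⟶ B) → (B ⟶ X) → Prop

namespace ExtriData

variable {C : Type u} [Category.{v} C] (D : ExtriData.{u, v, w} C)

/-- The class of `s`-conflations. -/
def Conflation : SeqClass C := fun _ _ _ f g => ∃ δ, D.Tri f g δ

/-- The class of `E`-injective objects. -/
def injectives : ObjectProperty C := fun I => ∀ (X : C) (δ : BiExt D.E X I), δ = 0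

def HasEnoughInjectives : Prop :=
  ∀ A : C, ∃ (I S : C) (f : A ⟶ I) (g : I ⟶ S), D.injectives I ∧ D.Conflation f g

/-- `N` is a full additive subcategory, closed under isomorphisms and under extensions. -/
structure IsExtensionClosed [Preadditive C] (N : ObjectProperty C) : Prop where
  zero : ∀ Z : C, IsZero Z → N Z
  iso : ∀ {A B : C}, (A ≅ B) → N A → N B
  sum : ∀ {A B : C} (P : BinaryBicone A B), P.IsBilimit → N A → N B → N P.pt
  ext : ∀ {A B X : C} (f : A ⟶ B) (g : B ⟶ X), D.Conflation f g → N A → N X → N B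

/-- If `A ⟶ B` is an inflation between objects of `N`, then its cone is in `N`. -/
def IsClosedUnderCones (N : ObjectProperty C) : Prop :=
  ∀ {A B X : C} (f : A ⟶ B) (g : B ⟶ X), D.Conflation f g → N A → N B → N X

/-- The inflations with cone in `N`. -/
def inflWithCone (N : ObjectProperty C) : MorphismProperty C :=
  fun _ _ f => ∃ (X : C) (g : _ ⟶ X), D.Conflation f g ∧ N X

/-- The deflations with cocone in `N`. -/
def deflWithCocone (N : ObjectProperty C) : MorphismProperty C :=
  fun _ _ g => ∃ (A : C) (f : A ⟶ _), D.Conflation f g ∧ N A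

/-- `W = Q_I ∘ K_N`: an inflation with cone in `N`, followed by a deflation with `E`-injective
cocone. -/
def weq (N : ObjectProperty C) : MorphismProperty C :=
  fun A B f => ∃ (X : C) (k : A ⟶ X) (q : X ⟶ B),
    D.inflWithCone N k ∧ D.deflWithCocone D.injectives q ∧ k ≫ q = f

/-- The restriction `(N, E|_N, s|_N)` to a full subcategory. -/
def restrict (N : ObjectProperty C) : ExtriData.{u, v, w} N.FullSubcategory where
  E := N.ι.op ⋙ D.E ⋙ (Functor.whiskeringLeft _ _ _).obj N.ι
  Tri := fun A _ X f g δ => D.Tri f.hom g.hom (show BiExt D.E X.obj A.obj from δ)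

end ExtriData

/-- Closure under direct summands. -/
def IsClosedUnderSummands {C : Type u} [Category.{v} C] [Preadditive C]
    (N : ObjectProperty C) : Prop :=
  ∀ {A B : C} (P : BinaryBicone A B), P.IsBilimit → N P.pt → N A

/-- Weak idempotent completeness: every section has a cokernel. -/
def IsWeaklyIdempotentComplete (C : Type u) [Category.{v} C] [Preadditive C] : Prop :=
  ∀ {A B : C} (f : A ⟶ B), IsSplitMono f → HasCokernel f

/-! ## Weak Waldhausen categories -/

namespace SeqClass

variable {C : Type u} [Category.{v} C]

def cofibrations (Seq : SeqClass C) : MorphismProperty C :=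
  fun _ _ f => ∃ (X : C) (g : _ ⟶ X), Seq f g

/-- The members of `Seq` that lie in the full subcategory `N`. -/
def restrict (Seq : SeqClass C) (N : ObjectProperty C) : SeqClass N.FullSubcategory :=
  fun _ _ _ f g => Seq f.hom g.hom

end SeqClass

/-- `(C, Seq, W)` is a weak Waldhausen (additive) category.  For `P = B ⊕ Z`, the morphism
`f ≫ P.inl - c ≫ P.inr` is the column with entries `f` and `-c`, and a morphism
`p` out of `P` is the row with entries `P.inl ≫ p` and `P.inr ≫ p`. -/
structure IsWeakWaldhausen {C : Type u} [Category.{v} C] [Preadditive C]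
    (Seq : SeqClass C) (W : MorphismProperty C) : Prop where
  additive : HasFiniteBiproducts C
  wc0_comp : Seq.cofibrations.IsStableUnderComposition
  wc0_iso : MorphismProperty.isomorphisms C ≤ Seq.cofibrations
  wc1_split : ∀ S : ShortComplex C, Nonempty S.Splitting → Seq S.f S.g
  wc1_iso : ∀ {A B X A' B' X' : C} {f : A ⟶ B} {g : B ⟶ X} {f' : A' ⟶ B'} {g' : B' ⟶ X'}
    (a : A ≅ A') (b : B ≅ B') (c : X ≅ X'), f ≫ b.hom = a.hom ≫ f' → g ≫ c.hom = b.hom ≫ g' →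
    Seq f g → Seq f' g'
  /-- `g` is a weak cokernel of `f`. -/
  wc1_weakCokernel : ∀ {A B X : C} {f : A ⟶ B} {g : B ⟶ X}, Seq f g →
    f ≫ g = 0 ∧ ∀ (Y : C) (h : B ⟶ Y), f ≫ h = 0 → ∃ k : X ⟶ Y, g ≫ k = h
  wc2_cofibration : ∀ {A B Z : C} (f : A ⟶ B) (c : A ⟶ Z) (P : BinaryBicone B Z), P.IsBilimit →
    Seq.cofibrations f → Seq.cofibrations (f ≫ P.inl - c ≫ P.inr)
  wc2_pushout : ∀ {A B Z X : C} (f : A ⟶ B) (c : A ⟶ Z) (P : BinaryBicone B Z) (p : P.pt ⟶ X),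
    P.IsBilimit → Seq.cofibrations f → Seq (f ≫ P.inl - c ≫ P.inr) p →
    Seq.cofibrations (P.inr ≫ p)
  ww0_comp : W.IsStableUnderComposition
  ww0_iso : MorphismProperty.isomorphisms C ≤ W
  /-- The gluing axiom. -/
  ww1 : ∀ {A₁ B₁ Z₁ X₁ A₂ B₂ Z₂ X₂ : C} (f₁ : A₁ ⟶ B₁) (c₁ : A₁ ⟶ Z₁) (f₂ : A₂ ⟶ B₂)
    (c₂ : A₂ ⟶ Z₂) (x : A₁ ⟶ A₂) (y : B₁ ⟶ B₂) (z : Z₁ ⟶ Z₂)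
    (P₁ : BinaryBicone B₁ Z₁) (P₂ : BinaryBicone B₂ Z₂) (p₁ : P₁.pt ⟶ X₁) (p₂ : P₂.pt ⟶ X₂),
    P₁.IsBilimit → P₂.IsBilimit →
    Seq.cofibrations f₁ → Seq.cofibrations f₂ → W x → W y → W z →
    f₁ ≫ y = x ≫ f₂ → c₁ ≫ z = x ≫ c₂ →
    Seq (f₁ ≫ P₁.inl - c₁ ≫ P₁.inr) p₁ → Seq (f₂ ≫ P₂.inl - c₂ ≫ P₂.inr) p₂ →
    ∃ q : X₁ ⟶ X₂, W q ∧ p₁ ≫ q = bisum P₁ P₂ y z ≫ p₂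

/-- The extension axiom. -/
def ExtensionAxiom {C : Type u} [Category.{v} C] (Seq : SeqClass C) (W : MorphismProperty C) :
    Prop :=
  ∀ {A₁ B₁ X₁ A₂ B₂ X₂ : C} {f₁ : A₁ ⟶ B₁} {g₁ : B₁ ⟶ X₁} {f₂ : A₂ ⟶ B₂} {g₂ : B₂ ⟶ X₂}
    (a : A₁ ⟶ A₂) (b : B₁ ⟶ B₂) (c : X₁ ⟶ X₂), Seq f₁ g₁ → Seq f₂ g₂ →
    f₁ ≫ b = a ≫ f₂ → g₁ ≫ c = b ≫ g₂ → W a → W c → W b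

/-- The `W`-acyclic objects: those `X` with `0 ⟶ X` in `W`. -/
def acyclic {C : Type u} [Category.{v} C] (W : MorphismProperty C) : ObjectProperty C :=
  fun X => ∃ (Z : C) (_ : IsZero Z) (i : Z ⟶ X), W i

/-- Exact functors between weak Waldhausen categories. -/
structure IsWaldExact {C : Type u} [Category.{v} C] [Preadditive C]
    {C' : Type u'} [Category.{v'} C'] [Preadditive C'] (F : C ⥤ C')
    (Seq : SeqClass C) (W : MorphismProperty C) (Seq' : SeqClass C') (W' : MorphismProperty C') :
    Prop where
  additive : F.Additive
  map_seq : ∀ {A B X : C} (f : A ⟶ B) (g : B ⟶ X), Seq f g → Seq' (F.map f) (F.map g)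
  map_weq : ∀ {A B : C} (f : A ⟶ B), W f → W' (F.map f)

/-- `(C^W, Seq^W, V^W) → (C, Seq, V) → (C, Seq, W)` is a sequence of weak Waldhausen categories
and exact functors (the inclusion and the identity), and it is a localization sequence. -/
structure IsLocalizationSequence {C : Type u} [Category.{v} C] [Preadditive C]
    (Seq : SeqClass C) (V W : MorphismProperty C) : Prop where
  wald_left : IsWeakWaldhausen (Seq.restrict (acyclic W)) (V.inverseImage (acyclic W).ι)
  wald_middle : IsWeakWaldhausen Seq V
  wald_right : IsWeakWaldhausen Seq W
  exact_inc : IsWaldExact (acyclic W).ι (Seq.restrict (acyclic W)) (V.inverseImage (acyclic W).ι)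
    Seq V
  exact_id : IsWaldExact (𝟭 C) Seq V Seq W
  extend : ∀ (C' : Type u') [Category.{v'} C'] [Preadditive C'] (Seq' : SeqClass C')
    (W' : MorphismProperty C'), IsWeakWaldhausen Seq' W' → W'.HasTwoOutOfThreeProperty →
    ExtensionAxiom Seq' W' → ∀ F : C ⥤ C', IsWaldExact F Seq V Seq' W' →
    (∀ X, acyclic W X → acyclic W' (F.obj X)) → IsWaldExact F Seq W Seq' W'

/-! ## Grothendieck groups -/

section K0

variable (C : Type u) [Category.{v} C] [Preadditive C]

/-- The subgroup generated by the `[A] - [B] + [X]` for `A ⟶ B ⟶ X` split exact. -/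
def splitRelations : AddSubgroup (FreeAbelianGroup C) :=
  AddSubgroup.closure {r | ∃ S : ShortComplex C, Nonempty S.Splitting ∧
    r = FreeAbelianGroup.of S.X₁ - FreeAbelianGroup.of S.X₂ + FreeAbelianGroup.of S.X₃}

/-- The split Grothendieck group. -/
abbrev K0Split : Type u := FreeAbelianGroup C ⧸ splitRelations C

variable {C}

def K0Split.cls (A : C) : K0Split C := QuotientAddGroup.mk (FreeAbelianGroup.of A)

lemma K0Split.cls_split (S : ShortComplex C) (h : S.Splitting) :
    K0Split.cls S.X₁ - K0Split.cls S.X₂ + K0Split.cls S.X₃ = 0 :=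
  (QuotientAddGroup.eq_zero_iff _).2 (AddSubgroup.subset_closure ⟨S, ⟨h⟩, rfl⟩)

lemma K0Split.cls_zero {Z : C} (hZ : IsZero Z) : K0Split.cls Z = 0 := by
  have h := K0Split.cls_split (ShortComplex.mk (0 : Z ⟶ Z) (0 : Z ⟶ Z) (by simp))
    { r := 0
      s := 0
      f_r := hZ.eq_of_src _ _
      s_g := hZ.eq_of_src _ _
      id := hZ.eq_of_src _ _ }
  simpa using h

lemma K0Split.cls_iso {Z A B : C} (hZ : IsZero Z) (e : A ≅ B) :
    K0Split.cls A = K0Split.cls B := by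
  have h := K0Split.cls_split (ShortComplex.mk e.hom (0 : B ⟶ Z) (by simp))
    { r := e.inv
      s := 0
      f_r := by simp
      s_g := hZ.eq_of_src _ _
      id := by simp }
  simp only [K0Split.cls_zero hZ, add_zero] at h
  exact sub_eq_zero.1 h

def K0Split.map {C' : Type u'} [Category.{v'} C'] [Preadditive C'] (F : C ⥤ C') (hF : F.Additive) :
    K0Split C →+ K0Split C' :=
  QuotientAddGroup.map _ _ (FreeAbelianGroup.map F.obj) (by
    rw [splitRelations, AddSubgroup.closure_le]
    rintro _ ⟨S, ⟨hS⟩, rfl⟩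
    exact AddSubgroup.subset_closure ⟨S.map F, ⟨hS.map F⟩, by simp⟩)

@[simp] lemma K0Split.map_cls {C' : Type u'} [Category.{v'} C'] [Preadditive C'] (F : C ⥤ C')
    (hF : F.Additive) (A : C) : K0Split.map F hF (K0Split.cls A) = K0Split.cls (F.obj A) := rfl

/-- The relations `[A] = [B]` for weak equivalences `A ⟶ B`, and `[B] = [A] + [X]` for
distinguished sequences `A ⟶ B ⟶ X`. -/
def waldRelations (Seq : SeqClass C) (W : MorphismProperty C) : AddSubgroup (K0Split C) :=
  AddSubgroup.closure
    ({r | ∃ (A B : C) (f : A ⟶ B), W f ∧ r = K0Split.cls A - K0Split.cls B} ∪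
      {r | ∃ (A B X : C) (f : A ⟶ B) (g : B ⟶ X), Seq f g ∧
        r = K0Split.cls B - (K0Split.cls A + K0Split.cls X)})

/-- The Grothendieck group `K₀(C, Seq, W)` of a weak Waldhausen category. -/
abbrev K0Wald (Seq : SeqClass C) (W : MorphismProperty C) : Type u :=
  K0Split C ⧸ waldRelations Seq W

/-- The homomorphism `K₀(F)`. -/
def K0Wald.map {C' : Type u'} [Category.{v'} C'] [Preadditive C'] {F : C ⥤ C'}
    {Seq : SeqClass C} {W : MorphismProperty C} {Seq' : SeqClass C'} {W' : MorphismProperty C'}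
    (hF : IsWaldExact F Seq W Seq' W') : K0Wald Seq W →+ K0Wald Seq' W' :=
  QuotientAddGroup.map _ _ (K0Split.map F hF.additive) (by
    rw [waldRelations, AddSubgroup.closure_le]
    rintro _ (⟨A, B, f, hf, rfl⟩ | ⟨A, B, X, f, g, hfg, rfl⟩)
    · exact AddSubgroup.subset_closure (Or.inl ⟨_, _, _, hF.map_weq f hf, by simp⟩)
    · exact AddSubgroup.subset_closure (Or.inr ⟨_, _, _, _, _, hF.map_seq f g hfg, by simp⟩))

/-- The subgroup generated by the `[A] - [B] + [X]` for `s`-triangles. -/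
def triRelations (D : ExtriData.{u, v, w} C) : AddSubgroup (K0Split C) :=
  AddSubgroup.closure {r | ∃ (A B X : C) (f : A ⟶ B) (g : B ⟶ X) (δ : BiExt D.E X A),
    D.Tri f g δ ∧ r = K0Split.cls A - K0Split.cls B + K0Split.cls X}

/-- The Grothendieck group `K₀(C, E, s)` of an extriangulated category. -/
abbrev K0Extri (D : ExtriData.{u, v, w} C) : Type u := K0Split C ⧸ triRelations D

/-- `K₀(N, E|_N, s|_N) → K₀(C, E, s)`, induced by the inclusion. -/
def K0Extri.inc (D : ExtriData.{u, v, w} C) (N : ObjectProperty C) :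
    K0Extri (D.restrict N) →+ K0Extri D :=
  QuotientAddGroup.map _ _ (K0Split.map N.ι inferInstance) (by
    rw [triRelations, AddSubgroup.closure_le]
    rintro _ ⟨A, B, X, f, g, δ, h, rfl⟩
    exact AddSubgroup.subset_closure ⟨A.obj, B.obj, X.obj, f.hom, g.hom, δ, h, by simp⟩)

/-- For the canonical weak Waldhausen structure (conflations and isomorphisms), the two
Grothendieck groups have the same relations. -/
lemma triRelations_eq_waldRelations [HasZeroObject C] (D : ExtriData.{u, v, w} C) :
    triRelations D = waldRelations D.Conflation (MorphismProperty.isomorphisms C) := by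
  apply le_antisymm
  · rw [triRelations, AddSubgroup.closure_le]
    rintro _ ⟨A, B, X, f, g, δ, h, rfl⟩
    have hm : K0Split.cls B - (K0Split.cls A + K0Split.cls X) ∈
        waldRelations D.Conflation (MorphismProperty.isomorphisms C) :=
      AddSubgroup.subset_closure (Or.inr ⟨A, B, X, f, g, ⟨δ, h⟩, rfl⟩)
    have := neg_mem hm
    rwa [show -(K0Split.cls B - (K0Split.cls A + K0Split.cls X)) =
      K0Split.cls A - K0Split.cls B + K0Split.cls X by abel] at this
  · rw [waldRelations, AddSubgroup.closure_le]
    rintro _ (⟨A, B, f, hf, rfl⟩ | ⟨A, B, X, f, g, ⟨δ, h⟩, rfl⟩)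
    · have : IsIso f := hf
      rw [K0Split.cls_iso (isZero_zero C) (asIso f), sub_self]
      exact zero_mem _
    · have hm : K0Split.cls A - K0Split.cls B + K0Split.cls X ∈ triRelations D :=
        AddSubgroup.subset_closure ⟨A, B, X, f, g, δ, h, rfl⟩
      have := neg_mem hm
      rwa [show -(K0Split.cls A - K0Split.cls B + K0Split.cls X) =
        K0Split.cls B - (K0Split.cls A + K0Split.cls X) by abel] at this

/-- The identification `K₀(C, E, s) = K₀(C, Seq, V)`, where `Seq` is the class of conflations and
`V` the class of isomorphisms. -/
def K0Extri.equivWald [HasZeroObject C] (D : ExtriData.{u, v, w} C) :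
    K0Extri D ≃+ K0Wald D.Conflation (MorphismProperty.isomorphisms C) :=
  QuotientAddGroup.quotientAddEquivOfEq (triRelations_eq_waldRelations D)

end K0

/-! A deflation `A ⟶ B` with injective cocone `I` has its class in `E(B, I) = 0`, so it is a
projection `B ⊕ I ⟶ B`. Hence `f : A ⟶ B` is a weak equivalence exactly when some column `(f, i) : A
⟶ B ⊕ I` with `I` injective is an inflation with cone in `N`. The choice of `i` is immaterial, by a
Schanuel argument (`inflWithCone_column_of_inflWithCone_column`): if `(f, i)` and `(f, j)` are
inflations with cones `X` and `Y`, then each of `i`, `j` extends along the other column, so `(f, i,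
j)` has both `X ⊕ J` and `Y ⊕ I` as cone, and closure under summands carries membership in `N` from
`X` to `Y`.

The gluing axiom is `exists_weq` applied to `x` and `y ⊕ z`. Adding an injective summand turns `x`
into an inflation with cone in `N`; the morphism of conflations then factors through the pushout of
`f₁` along `x`, and (ET4) compares the cones.

An exact functor that kills `N` inverts inflations with cone in `N` up to `W'` by the extension
axiom, and projections with injective kernel by 2-out-of-3 applied to a section. In `K₀`, a weak
equivalence `A ⟶ B` with cone `X` and injective `I` satisfies `[A] - [B] = [I] - [X]`, a difference
of classes from `N`. -/

namespace BiExt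

variable {C : Type u} [Category.{v} C] {E : Cᵒᵖ ⥤ C ⥤ AddCommGrpCat.{w}}

@[simp] lemma push_id {X A : C} (δ : BiExt E X A) : BiExt.push (𝟙 A) δ = δ := by
  simp [BiExt.push]

@[simp] lemma pull_id {X A : C} (δ : BiExt E X A) : BiExt.pull (𝟙 X) δ = δ := by
  simp [BiExt.pull]

@[simp] lemma push_zero {X A A' : C} (a : A ⟶ A') : BiExt.push a (0 : BiExt E X A) = 0 :=
  map_zero _

lemma push_comp {X A A' A'' : C} (a : A ⟶ A') (a' : A' ⟶ A'') (δ : BiExt E X A) :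
    BiExt.push (a ≫ a') δ = BiExt.push a' (BiExt.push a δ) := by
  simp [BiExt.push]

lemma pull_comp {X X' X'' A : C} (c : X' ⟶ X) (c' : X'' ⟶ X') (δ : BiExt E X A) :
    BiExt.pull (c' ≫ c) δ = BiExt.pull c' (BiExt.pull c δ) := by
  simp [BiExt.pull]

lemma push_pull {X X' A A' : C} (a : A ⟶ A') (c : X' ⟶ X) (δ : BiExt E X A) :
    BiExt.push a (BiExt.pull c δ) = BiExt.pull c (BiExt.push a δ) := by
  have := (E.map c.op).naturality a
  exact (ConcreteCategory.congr_hom this δ).symm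

end BiExt

/-! ### Direct sums and their changes of coordinates -/

section Bicones

variable {C : Type u} [Category.{v} C] [Preadditive C]

/-- The zero bicone: `A` is the direct sum of `A` and a zero object. -/
@[simps]
def zeroBicone (A : C) {Z : C} (hZ : IsZero Z) : BinaryBicone A Z where
  pt := A
  fst := 𝟙 A
  snd := 0
  inl := 𝟙 A
  inr := 0
  inl_snd := by simp
  inr_fst := by simp
  inr_snd := hZ.eq_of_src _ _

/-- The direct sum of a zero object and `A` is `A`. -/
@[simps]
def zeroBicone' (A : C) {Z : C} (hZ : IsZero Z) : BinaryBicone Z A where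
  pt := A
  fst := 0
  snd := 𝟙 A
  inl := 0
  inr := 𝟙 A
  inl_snd := by simp
  inr_fst := by simp
  inl_fst := hZ.eq_of_src _ _

def zeroBiconeIsBilimit (A : C) {Z : C} (hZ : IsZero Z) : (zeroBicone A hZ).IsBilimit :=
  isBinaryBilimitOfTotal _ (show 𝟙 A ≫ 𝟙 A + (0 : A ⟶ Z) ≫ (0 : Z ⟶ A) = 𝟙 A by simp)

def zeroBiconeIsBilimit' (A : C) {Z : C} (hZ : IsZero Z) : (zeroBicone' A hZ).IsBilimit :=
  isBinaryBilimitOfTotal _ (show (0 : A ⟶ Z) ≫ (0 : Z ⟶ A) + 𝟙 A ≫ 𝟙 A = 𝟙 A by simp)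

/-- The bicone with the two summands exchanged. -/
@[simps]
def swapBicone {A B : C} (P : BinaryBicone A B) : BinaryBicone B A where
  pt := P.pt
  fst := P.snd
  snd := P.fst
  inl := P.inr
  inr := P.inl

def swapBiconeIsBilimit {A B : C} {P : BinaryBicone A B} (hP : P.IsBilimit) :
    (swapBicone P).IsBilimit :=
  isBinaryBilimitOfTotal _ ((add_comm _ _).trans (IsBilimit.binary_total hP))

/-- A direct sum seen through the automorphism `(x, y) ↦ (x, y + x ≫ t)`. -/
@[simps]
def shearBicone {A B : C} (P : BinaryBicone A B) (t : A ⟶ B) : BinaryBicone A B where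
  pt := P.pt
  fst := P.fst
  snd := P.snd - P.fst ≫ t
  inl := P.inl + t ≫ P.inr
  inr := P.inr

def shearBiconeIsBilimit {A B : C} {P : BinaryBicone A B} (hP : P.IsBilimit) (t : A ⟶ B) :
    (shearBicone P t).IsBilimit :=
  isBinaryBilimitOfTotal _
    (show P.fst ≫ (P.inl + t ≫ P.inr) + (P.snd - P.fst ≫ t) ≫ P.inr = 𝟙 P.pt by
      rw [← IsBilimit.binary_total hP]; simp)

lemma bicone_total_comp {A B X : C} {P : BinaryBicone A B} (hP : P.IsBilimit) (f : P.pt ⟶ X) :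
    P.fst ≫ P.inl ≫ f + P.snd ≫ P.inr ≫ f = f := by
  rw [← Category.assoc, ← Category.assoc, ← Preadditive.add_comp, IsBilimit.binary_total hP,
    Category.id_comp]

/-- The direct sum of two isomorphisms. -/
@[simps]
def bisumIso {A A' B B' : C} {P : BinaryBicone A A'} (hP : P.IsBilimit)
    {Q : BinaryBicone B B'} (hQ : Q.IsBilimit) (f : A ≅ B) (f' : A' ≅ B') : P.pt ≅ Q.pt where
  hom := bisum P Q f.hom f'.hom
  inv := bisum Q P f.inv f'.inv
  hom_inv_id := by
    rw [← IsBilimit.binary_total hP]; simp [bisum]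
  inv_hom_id := by
    rw [← IsBilimit.binary_total hQ]; simp [bisum]

end Bicones

/-- A morphism whose difference with the identity squares to zero is an isomorphism. -/
lemma isIso_of_sub_id_sq {C : Type u} [Category.{v} C] [Preadditive C] {X : C} (e : X ⟶ X)
    (h : (e - 𝟙 X) ≫ (e - 𝟙 X) = 0) : IsIso e := by
  have h' : e ≫ e - e - e + 𝟙 X = 0 := by
    rw [← h]; simp only [Preadditive.sub_comp, Preadditive.comp_sub, Category.id_comp,
      Category.comp_id]; abel
  refine ⟨𝟙 X - (e - 𝟙 X), ?_, ?_⟩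
  · rw [← sub_eq_zero, ← neg_eq_zero, ← h']
    simp only [Preadditive.comp_sub, Category.comp_id]; abel
  · rw [← sub_eq_zero, ← neg_eq_zero, ← h']
    simp only [Preadditive.sub_comp, Category.id_comp]; abel

lemma isIso_of_comp_isIso {C : Type u} [Category.{v} C] {X Y : C} (a : X ⟶ Y) (b : Y ⟶ X)
    (h₁ : IsIso (a ≫ b)) (h₂ : IsIso (b ≫ a)) : IsIso a := by
  refine ⟨b ≫ inv (a ≫ b), by rw [← Category.assoc]; simp, ?_⟩
  have e : inv (b ≫ a) ≫ b ≫ a = 𝟙 Y := by simp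
  have : b ≫ inv (a ≫ b) = inv (b ≫ a) ≫ b := by
    rw [IsIso.comp_inv_eq, Category.assoc, IsIso.eq_inv_comp]; simp
  rw [this, Category.assoc, e]

/-! ### Cones, pushouts and the canonical Waldhausen structure -/

namespace ExtriData.IsExtriangulated

variable {C : Type u} [Category.{v} C] [Preadditive C] {D : ExtriData.{u, v, w} C}
  (hD : D.IsExtriangulated)

include hD

lemma exists_isZero : ∃ Z : C, IsZero Z := by
  have := hD.additive
  exact ⟨_, isZero_zero C⟩

lemma hasBinaryBiproducts : HasBinaryBiproducts C := by
  have := hD.additive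
  exact HasBinaryBiproducts.of_hasBinaryProducts

lemma tri_id_left (A : C) {Z : C} (hZ : IsZero Z) : D.Tri (𝟙 A) (0 : A ⟶ Z) 0 :=
  hD.tri_zero (zeroBicone A hZ) (zeroBiconeIsBilimit A hZ)

lemma tri_id_right (A : C) {Z : C} (hZ : IsZero Z) : D.Tri (0 : Z ⟶ A) (𝟙 A) 0 :=
  hD.tri_zero (zeroBicone' A hZ) (zeroBiconeIsBilimit' A hZ)

variable {A B X : C} {f : A ⟶ B} {g : B ⟶ X} {δ : BiExt D.E X A}

lemma comp_eq_zero (h : D.Tri f g δ) : f ≫ g = 0 := by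
  obtain ⟨O, hO⟩ := hD.exists_isZero
  obtain ⟨c, hc, -⟩ := hD.et3 (𝟙 A) f (hD.tri_id_left A hO) h rfl
  rw [← hc, zero_comp]

lemma exists_desc (h : D.Tri f g δ) {Y : C} (k : B ⟶ Y) (hk : f ≫ k = 0) :
    ∃ l : X ⟶ Y, g ≫ l = k := by
  obtain ⟨O, hO⟩ := hD.exists_isZero
  obtain ⟨c, hc, -⟩ := hD.et3 0 k h (hD.tri_id_right Y hO) (by simp [hk])
  exact ⟨c, by simpa using hc⟩

/-- When the pulled-back class vanishes, (ET2) maps the split sequence on `A ⊕ T` to the given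
triangle; the restriction to `T` is the lift. -/
lemma exists_lift_of_pull_eq_zero (h : D.Tri f g δ) {T : C} (c : T ⟶ X) (hc : δ.pull c = 0) :
    ∃ l : T ⟶ B, l ≫ g = c := by
  have := hD.hasBinaryBiproducts
  obtain ⟨b, -, hb⟩ := hD.realize (𝟙 A) c
    (hD.tri_zero (BinaryBiproduct.bicone A T) (BinaryBiproduct.isBilimit A T)) h (by simp [hc])
  refine ⟨biprod.inr ≫ b, ?_⟩
  rw [Category.assoc, ← hb]
  simp

lemma exists_desc_of_push_eq_zero (h : D.Tri f g δ) {T : C} (a : A ⟶ T) (ha : δ.push a = 0) :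
    ∃ l : B ⟶ T, f ≫ l = a := by
  have := hD.hasBinaryBiproducts
  obtain ⟨b, hb, -⟩ := hD.realize a (𝟙 X) h
    (hD.tri_zero (BinaryBiproduct.bicone T X) (BinaryBiproduct.isBilimit T X)) (by simp [ha])
  refine ⟨b ≫ biprod.fst, ?_⟩
  rw [← Category.assoc, hb]
  simp

lemma exists_desc_of_injective (h : D.Conflation f g) {I : C} (hI : D.injectives I) (a : A ⟶ I) :
    ∃ l : B ⟶ I, f ≫ l = a := by
  obtain ⟨δ, h⟩ := h
  exact hD.exists_desc_of_push_eq_zero h a (hI _ _)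

lemma conflation_comp_eq_zero (h : D.Conflation f g) : f ≫ g = 0 := by
  obtain ⟨δ, h⟩ := h
  exact hD.comp_eq_zero h

lemma conflation_desc (h : D.Conflation f g) {Y : C} (k : B ⟶ Y) (hk : f ≫ k = 0) :
    ∃ l : X ⟶ Y, g ≫ l = k := by
  obtain ⟨δ, h⟩ := h
  exact hD.exists_desc h k hk

/-- The class of conflations is closed under isomorphisms. -/
lemma conflation_of_iso {A' B' X' : C} {f' : A' ⟶ B'} {g' : B' ⟶ X'} (a : A ≅ A') (b : B ≅ B')
    (c : X ≅ X') (h₁ : f ≫ b.hom = a.hom ≫ f') (h₂ : g ≫ c.hom = b.hom ≫ g')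
    (h : D.Conflation f g) : D.Conflation f' g' := by
  obtain ⟨δ, h⟩ := h
  -- Realize the class transported along `a` and `c`; its middle term turns out to be isomorphic to
  -- `B`.
  obtain ⟨B'', f'', g'', h''⟩ := hD.exists_tri ((δ.pull c.inv).push a.hom)
  obtain ⟨s, hs₁, hs₂⟩ := hD.realize a.hom c.hom h h''
    (by rw [BiExt.push_pull, ← BiExt.pull_comp]; simp)
  obtain ⟨t, ht₁, ht₂⟩ := hD.realize a.inv c.inv h'' h
    (by rw [← BiExt.push_comp]; simp)
  -- `e - 𝟙` factors through `g` because it vanishes on `f`, and it is killed by `g`; so it squares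
  -- to zero.
  have key : ∀ {A B X : C} {f : A ⟶ B} {g : B ⟶ X} {δ : BiExt D.E X A} (_ : D.Tri f g δ)
      (e : B ⟶ B), f ≫ e = f → e ≫ g = g → IsIso e := by
    intro A B X f g δ h e h₁ h₂
    obtain ⟨l, hl⟩ := hD.exists_desc h (e - 𝟙 B) (by simp [h₁])
    apply isIso_of_sub_id_sq
    rw [← hl, ← Category.assoc, hl]
    simp only [Preadditive.sub_comp, Category.id_comp, h₂, sub_self, zero_comp]
  have : IsIso s := isIso_of_comp_isIso s t
    (key h _ (by rw [← Category.assoc, hs₁, Category.assoc, ht₁]; simp)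
      (by rw [Category.assoc, ← ht₂, ← Category.assoc, ← hs₂]; simp))
    (key h'' _ (by rw [← Category.assoc, ht₁, Category.assoc, hs₁]; simp)
      (by rw [Category.assoc, ← hs₂, ← Category.assoc, ← ht₂]; simp))
  refine ⟨_, (hD.tri_iff f' g' h'').2 ⟨(asIso s).symm ≪≫ b, ?_, ?_⟩⟩
  · have : f'' = a.inv ≫ f ≫ s := by rw [hs₁]; simp
    simp [this, h₁]
  · have : g'' = inv s ≫ g ≫ c.hom := by rw [hs₂]; simp
    simp [this, h₂]

/-- The cone of an inflation is unique up to isomorphism. -/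
lemma exists_cone_iso {X' : C} {g' : B ⟶ X'} (h : D.Conflation f g) (h' : D.Conflation f g') :
    ∃ c : X ≅ X', g ≫ c.hom = g' := by
  obtain ⟨δ, h⟩ := h
  obtain ⟨δ', h'⟩ := h'
  -- Dual argument: `e` fixes `δ`, so `e - 𝟙` lifts through `g`, while `g ≫ (e - 𝟙) = 0`.
  have key : ∀ {X : C} {g : B ⟶ X} {δ : BiExt D.E X A} (_ : D.Tri f g δ)
      (e : X ⟶ X), g ≫ e = g → δ.pull e = δ → IsIso e := by
    intro X g δ h e h₁ h₂
    have := hD.additive_left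
    obtain ⟨l, hl⟩ := hD.exists_lift_of_pull_eq_zero h (e - 𝟙 X) (by
      have : BiExt.pull (e - 𝟙 X) δ = BiExt.pull e δ - BiExt.pull (𝟙 X) δ := by
        simp [BiExt.pull, Functor.map_sub]
      rw [this, h₂]; simp)
    apply isIso_of_sub_id_sq
    nth_rw 1 [← hl]
    simp [h₁]
  obtain ⟨c, hc, hδ⟩ := hD.et3 (𝟙 A) (𝟙 B) h h' (by simp)
  obtain ⟨d, hd, hδ'⟩ := hD.et3 (𝟙 A) (𝟙 B) h' h (by simp)
  simp only [Category.id_comp, BiExt.push_id] at hc hd hδ hδ'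
  have : IsIso c := isIso_of_comp_isIso c d
    (key h _ (by rw [← Category.assoc, hc, hd]) (by rw [BiExt.pull_comp, ← hδ', ← hδ]))
    (key h' _ (by rw [← Category.assoc, hd, hc]) (by rw [BiExt.pull_comp, ← hδ, ← hδ']))
  exact ⟨asIso c, hc⟩

/-- Isomorphic inflations have isomorphic cones. -/
lemma exists_cone_iso' {A' B' X' : C} {f' : A' ⟶ B'} {g' : B' ⟶ X'} (a : A ≅ A') (b : B ≅ B')
    (h₁ : f ≫ b.hom = a.hom ≫ f') (h : D.Conflation f g) (h' : D.Conflation f' g') :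
    ∃ c : X ≅ X', g ≫ c.hom = b.hom ≫ g' := by
  have := hD.conflation_of_iso (f' := f') (g' := b.inv ≫ g) a b (Iso.refl X) h₁ (by simp) h
  obtain ⟨c, hc⟩ := hD.exists_cone_iso this h'
  exact ⟨c, by rw [← hc]; simp⟩

lemma conflation_postcomp {B' X' : C} (b : B ≅ B') (c : X ≅ X') (h : D.Conflation f g) :
    D.Conflation (f ≫ b.hom) (b.inv ≫ g ≫ c.hom) :=
  hD.conflation_of_iso (Iso.refl A) b c (by simp) (by simp) h

lemma conflation_split {A X : C} (P : BinaryBicone A X) (hP : P.IsBilimit) :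
    D.Conflation P.inl P.snd := ⟨0, hD.tri_zero P hP⟩

lemma conflation_sum {A' B' X' : C} {f' : A' ⟶ B'} {g' : B' ⟶ X'}
    {P : BinaryBicone A A'} {Q : BinaryBicone B B'} {R : BinaryBicone X X'}
    (hP : P.IsBilimit) (hQ : Q.IsBilimit) (hR : R.IsBilimit) (h : D.Conflation f g)
    (h' : D.Conflation f' g') : D.Conflation (bisum P Q f f') (bisum Q R g g') := by
  obtain ⟨δ, h⟩ := h
  obtain ⟨δ', h'⟩ := h'
  exact ⟨_, hD.tri_sum P Q R hP hQ hR h h'⟩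

lemma conflation_sum_id_left {Z : C} {P : BinaryBicone A Z} {Q : BinaryBicone B Z}
    (hP : P.IsBilimit) (hQ : Q.IsBilimit) (h : D.Conflation f g) :
    D.Conflation (bisum P Q f (𝟙 Z)) (Q.fst ≫ g) := by
  obtain ⟨O, hO⟩ := hD.exists_isZero
  have H := hD.conflation_sum hP hQ (zeroBiconeIsBilimit X hO) h
    ⟨_, hD.tri_id_left Z hO⟩
  have e : bisum Q (zeroBicone X hO) g (0 : Z ⟶ _) = Q.fst ≫ g :=
    show Q.fst ≫ g ≫ 𝟙 X + Q.snd ≫ (0 : Z ⟶ O) ≫ (0 : O ⟶ X) = Q.fst ≫ g by simp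
  rwa [e] at H

lemma conflation_sum_id_right {Z : C} {Q : BinaryBicone B Z} {R : BinaryBicone X Z}
    (hQ : Q.IsBilimit) (hR : R.IsBilimit) (h : D.Conflation f g) :
    D.Conflation (f ≫ Q.inl) (bisum Q R g (𝟙 Z)) := by
  obtain ⟨O, hO⟩ := hD.exists_isZero
  have H := hD.conflation_sum (zeroBiconeIsBilimit A hO) hQ hR h
    ⟨_, hD.tri_id_right Z hO⟩
  have e : bisum (zeroBicone A hO) Q f (0 : _ ⟶ Z) = f ≫ Q.inl :=
    show 𝟙 A ≫ f ≫ Q.inl + (0 : A ⟶ O) ≫ (0 : O ⟶ Z) ≫ Q.inr = f ≫ Q.inl by simp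
  rwa [e] at H

/-- If `h` factors through an inflation `f`, then the cone of `(f, h)` is the direct sum
of the cone of `f` and the target of `h`. -/
lemma conflation_shear {Z : C} {P : BinaryBicone B Z} {Q : BinaryBicone X Z}
    (hP : P.IsBilimit) (hQ : Q.IsBilimit) (h : D.Conflation f g) (t : B ⟶ Z) :
    D.Conflation (f ≫ P.inl + (f ≫ t) ≫ P.inr)
      (P.fst ≫ g ≫ Q.inl + (P.snd - P.fst ≫ t) ≫ Q.inr) := by
  have H : D.Conflation (f ≫ (P.inl + t ≫ P.inr))
      (P.fst ≫ g ≫ Q.inl + (P.snd - P.fst ≫ t) ≫ 𝟙 Z ≫ Q.inr) :=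
    hD.conflation_sum_id_right (shearBiconeIsBilimit hP t) hQ h
  simpa using H

/-- (ET4) without the extension classes: the cones of two inflations and of their composite form a
conflation. -/
lemma inflation_comp {Y Z : C} {g' : B ⟶ Y} {r : Y ⟶ Z} (h : D.Conflation f g)
    (h' : D.Conflation g' r) :
    ∃ (W : C) (k : Y ⟶ W) (d : X ⟶ W) (e : W ⟶ Z), D.Conflation (f ≫ g') k ∧
      D.Conflation d e ∧ g ≫ d = g' ≫ k ∧ k ≫ e = r := by
  obtain ⟨δ, h⟩ := h
  obtain ⟨δ', h'⟩ := h'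
  obtain ⟨W, k, d, e, δ'', h₁, h₂, h₃, h₄, -⟩ := hD.et4 h h'
  exact ⟨W, k, d, e, ⟨_, h₁⟩, ⟨_, h₂⟩, h₃, h₄⟩

/-- Pushouts of conflations: `A ⟶ B ⊕ Z ⟶ Y` is a conflation, and `Z ⟶ Y` has the same cone
as `f : A ⟶ B`. -/
lemma exists_pushout {Z : C} (h : D.Conflation f g) (c : A ⟶ Z) {P : BinaryBicone B Z}
    (hP : P.IsBilimit) :
    ∃ (Y : C) (p : P.pt ⟶ Y) (e : Y ⟶ X), D.Conflation (f ≫ P.inl - c ≫ P.inr) p ∧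
      D.Conflation (P.inr ≫ p) e ∧ P.inl ≫ p ≫ e = g := by
  have := hD.hasBinaryBiproducts
  obtain ⟨S, hS⟩ : ∃ S : BinaryBicone A Z, Nonempty S.IsBilimit :=
    ⟨_, ⟨BinaryBiproduct.isBilimit A Z⟩⟩
  have hS := hS.some
  -- The column `(f, -c)` is the split inflation `(1, -c) : A ⟶ A ⊕ Z`, with cone `Z`, followed by
  -- `f ⊕ 1`, with cone `X`. Comparing cones gives `Z ⟶ W ⟶ X`.
  have h₁ : D.Conflation (S.inl + (-c) ≫ S.inr) (S.snd - S.fst ≫ (-c)) :=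
    hD.conflation_split _ (shearBiconeIsBilimit hS (-c))
  obtain ⟨W, k, d, e, h₃, h₄, h₅, h₆⟩ :=
    hD.inflation_comp h₁ (hD.conflation_sum_id_left hS hP h)
  have h₇ : d = P.inr ≫ k := by
    have := congrArg (S.inr ≫ ·) h₅
    simpa [bisum] using this
  refine ⟨W, k, e, ?_, h₇ ▸ h₄, by simp [h₆]⟩
  convert h₃ using 1
  simp [bisum, sub_eq_add_neg]

/-- For every pushout conflation, `Z ⟶ Y` has the same cone as `f : A ⟶ B`. -/
lemma conflation_of_pushout {Z Y : C} (h : D.Conflation f g) (c : A ⟶ Z) {P : BinaryBicone B Z}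
    (hP : P.IsBilimit) {p : P.pt ⟶ Y} (hp : D.Conflation (f ≫ P.inl - c ≫ P.inr) p) :
    ∃ e : Y ⟶ X, D.Conflation (P.inr ≫ p) e ∧ P.inl ≫ p ≫ e = g := by
  obtain ⟨Y', p', e, h₁, h₂, h₃⟩ := hD.exists_pushout h c hP
  obtain ⟨φ, hφ⟩ := hD.exists_cone_iso h₁ hp
  refine ⟨φ.inv ≫ e, ?_, by simp [← hφ, h₃]⟩
  have := hD.conflation_postcomp φ (Iso.refl X) h₂
  simpa [hφ] using this

/-- The canonical weak Waldhausen structure of an extriangulated category. -/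
theorem isWeakWaldhausen_isomorphisms :
    IsWeakWaldhausen D.Conflation (MorphismProperty.isomorphisms C) where
  additive := hD.additive
  wc0_comp := ⟨fun f g ⟨_, _, hf⟩ ⟨_, _, hg⟩ => by
    obtain ⟨W, k, -, -, h, -⟩ := hD.inflation_comp hf hg
    exact ⟨W, k, h⟩⟩
  wc0_iso := fun A B f (hf : IsIso f) => by
    obtain ⟨O, hO⟩ := hD.exists_isZero
    exact ⟨O, 0, hD.conflation_of_iso (Iso.refl A) (asIso f) (Iso.refl _) (by simp) (by simp)
      ⟨_, hD.tri_id_left A hO⟩⟩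
  wc1_split := fun S ⟨s⟩ => hD.conflation_split
    { pt := S.X₂, fst := s.r, snd := S.g, inl := S.f, inr := s.s }
    (isBinaryBilimitOfTotal _ s.id)
  wc1_iso := fun a b c h₁ h₂ h => hD.conflation_of_iso a b c h₁ h₂ h
  wc1_weakCokernel := fun h => ⟨hD.conflation_comp_eq_zero h, fun _ k hk =>
    hD.conflation_desc h k hk⟩
  wc2_cofibration := fun f c P hP ⟨_, _, hf⟩ => by
    obtain ⟨Y, p, e, h, -⟩ := hD.exists_pushout hf c hP
    exact ⟨Y, p, h⟩
  wc2_pushout := fun f c P p hP ⟨_, _, hf⟩ hp => by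
    obtain ⟨e, he, -⟩ := hD.conflation_of_pushout hf c hP hp
    exact ⟨_, e, he⟩
  ww0_comp := inferInstance
  ww0_iso := le_rfl
  ww1 := fun f₁ c₁ f₂ c₂ x y z P₁ P₂ p₁ p₂ hP₁ hP₂ _ _ (hx : IsIso x) (hy : IsIso y)
      (hz : IsIso z) h₁ h₂ hp₁ hp₂ => by
    obtain ⟨q, hq⟩ := hD.exists_cone_iso' (asIso x) (bisumIso hP₁ hP₂ (asIso y) (asIso z))
      (by simp [bisum, reassoc_of% h₁, reassoc_of% h₂, sub_eq_add_neg]) hp₁ hp₂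
    exact ⟨q.hom, inferInstanceAs (IsIso q.hom), by simpa using hq⟩

end ExtriData.IsExtriangulated

/-! ### Weak equivalences as columns, and the gluing axiom -/

namespace ExtriData.IsExtriangulated

variable {C : Type u} [Category.{v} C] [Preadditive C] {D : ExtriData.{u, v, w} C}
  (hD : D.IsExtriangulated)

include hD

lemma injectives_of_isZero {Z : C} (hZ : IsZero Z) : D.injectives Z := fun X δ => by
  have := hD.additive_right (op X)
  have : δ = BiExt.push (0 : Z ⟶ Z) δ := by
    rw [← hZ.eq_of_src (𝟙 Z) 0, BiExt.push_id]
  rw [this]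
  simp [BiExt.push]

lemma injectives_sum {I J : C} (P : BinaryBicone I J) (hP : P.IsBilimit) (hI : D.injectives I)
    (hJ : D.injectives J) : D.injectives P.pt := fun X δ => by
  have := hD.additive_right (op X)
  have key : BiExt.push (P.fst ≫ P.inl + P.snd ≫ P.inr) δ =
      BiExt.push (P.fst ≫ P.inl) δ + BiExt.push (P.snd ≫ P.inr) δ := by
    simp only [BiExt.push, Functor.map_add]
    rfl
  rwa [IsBilimit.binary_total hP, BiExt.push_id, BiExt.push_comp, BiExt.push_comp,
    hI _ (BiExt.push P.fst δ), hJ _ (BiExt.push P.snd δ), BiExt.push_zero, BiExt.push_zero,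
    add_zero] at key

variable {N : ObjectProperty C} (hN : D.IsExtensionClosed N)

include hN

lemma prop_of_conflation {A B X : C} {f : A ⟶ B} {g : B ⟶ X} (hf : D.inflWithCone N f)
    (h : D.Conflation f g) : N X := by
  obtain ⟨X', g', h', hX'⟩ := hf
  obtain ⟨c, -⟩ := hD.exists_cone_iso h' h
  exact hN.iso c hX'

lemma inflWithCone_comp {A B X : C} {f : A ⟶ B} {g : B ⟶ X} (hf : D.inflWithCone N f)
    (hg : D.inflWithCone N g) : D.inflWithCone N (f ≫ g) := by
  obtain ⟨Y, p, h, hY⟩ := hf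
  obtain ⟨Z, q, h', hZ⟩ := hg
  obtain ⟨W, k, d, e, h₁, h₂, -⟩ := hD.inflation_comp h h'
  exact ⟨W, k, h₁, hN.ext d e h₂ hY hZ⟩

/-- The cone of `g` is the cone of the inflation from the cone of `f` to that of `f ≫ g`, so closure
under cones applies. -/
lemma inflWithCone_of_comp (hcone : D.IsClosedUnderCones N) {A B X : C} {f : A ⟶ B} {g : B ⟶ X}
    (hf : D.inflWithCone N f) (hg : D.Conflation.cofibrations g)
    (hfg : D.inflWithCone N (f ≫ g)) : D.inflWithCone N g := by
  obtain ⟨Y, p, h, hY⟩ := hf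
  obtain ⟨Z, q, h'⟩ := hg
  obtain ⟨W, k, d, e, h₁, h₂, -⟩ := hD.inflation_comp h h'
  exact ⟨Z, q, h', hcone d e h₂ hY (hD.prop_of_conflation hN hfg h₁)⟩

lemma inflWithCone_sum {A B A' B' : C} {f : A ⟶ B} {f' : A' ⟶ B'} {P : BinaryBicone A A'}
    {Q : BinaryBicone B B'} (hP : P.IsBilimit) (hQ : Q.IsBilimit) (hf : D.inflWithCone N f)
    (hf' : D.inflWithCone N f') : D.inflWithCone N (bisum P Q f f') := by
  obtain ⟨Y, p, h, hY⟩ := hf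
  obtain ⟨Z, q, h', hZ⟩ := hf'
  have := hD.hasBinaryBiproducts
  exact ⟨_, _, hD.conflation_sum hP hQ (BinaryBiproduct.isBilimit Y Z) h h',
    hN.sum _ (BinaryBiproduct.isBilimit Y Z) hY hZ⟩

lemma inflWithCone_id (A : C) : D.inflWithCone N (𝟙 A) := by
  obtain ⟨O, hO⟩ := hD.exists_isZero
  exact ⟨O, 0, ⟨_, hD.tri_id_left A hO⟩, hN.zero O hO⟩

omit hN in
lemma inflWithCone_postcomp_iso {A B B' : C} {f : A ⟶ B} (e : B ≅ B')
    (hf : D.inflWithCone N f) : D.inflWithCone N (f ≫ e.hom) := by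
  obtain ⟨Y, p, h, hY⟩ := hf
  exact ⟨Y, _, hD.conflation_postcomp e (Iso.refl Y) h, hY⟩

omit hN in
/-- A column of an inflation and an arbitrary morphism is an inflation. -/
lemma inflation_column {A B Z : C} {f : A ⟶ B} (hf : D.Conflation.cofibrations f) (c : A ⟶ Z)
    {P : BinaryBicone B Z} (hP : P.IsBilimit) :
    D.Conflation.cofibrations (f ≫ P.inl + c ≫ P.inr) := by
  obtain ⟨X, g, h⟩ := hf
  obtain ⟨Y, p, e, h', -⟩ := hD.exists_pushout h (-c) hP
  exact ⟨Y, p, by simpa using h'⟩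

omit hN in
lemma inflation_comp_cofibrations {A B X : C} {f : A ⟶ B} {g : B ⟶ X}
    (hf : D.Conflation.cofibrations f) (hg : D.Conflation.cofibrations g) :
    D.Conflation.cofibrations (f ≫ g) :=
  hD.isWeakWaldhausen_isomorphisms.wc0_comp.comp_mem _ _ hf hg

/-- Whether a column of `f` and a morphism to an injective object is an inflation with cone in `N`
does not depend on that morphism, as long as the column is an inflation. -/
lemma inflWithCone_column_of_inflWithCone_column (hI : D.injectives ≤ N)
    (hsum : IsClosedUnderSummands N)
    {A B I J : C} {f : A ⟶ B} {i : A ⟶ I} {j : A ⟶ J} (hI' : D.injectives I)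
    (hJ : D.injectives J) {P : BinaryBicone B I} (hP : P.IsBilimit) {Q : BinaryBicone B J}
    (hQ : Q.IsBilimit) (h : D.inflWithCone N (f ≫ P.inl + i ≫ P.inr))
    (h' : D.Conflation.cofibrations (f ≫ Q.inl + j ≫ Q.inr)) :
    D.inflWithCone N (f ≫ Q.inl + j ≫ Q.inr) := by
  obtain ⟨X, g, h, hX⟩ := h
  obtain ⟨Y, p, h'⟩ := h'
  have := hD.hasBinaryBiproducts
  obtain ⟨t, ht⟩ := hD.exists_desc_of_injective h hJ j
  obtain ⟨s, hs⟩ := hD.exists_desc_of_injective h' hI' i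
  -- Regroups `(B ⊕ I) ⊕ J` as `(B ⊕ J) ⊕ I`, so that `(f, i, j)` is an extension of either column.
  let R : BinaryBicone Q.pt I :=
    { pt := P.pt ⊞ J
      fst := biprod.fst ≫ P.fst ≫ Q.inl + biprod.snd ≫ Q.inr
      snd := biprod.fst ≫ P.snd
      inl := Q.fst ≫ P.inl ≫ biprod.inl + Q.snd ≫ biprod.inr
      inr := P.inr ≫ biprod.inl
      inl_fst := by rw [← IsBilimit.binary_total hQ]; simp }
  have hR : R.IsBilimit := isBinaryBilimitOfTotal _ <| by
    simp only [R]
    apply biprod.hom_ext'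
    · simp [bicone_total_comp hP]
    · simp
  have h₁ := hD.conflation_shear (BinaryBiproduct.isBilimit P.pt J)
    (BinaryBiproduct.isBilimit X J) h t
  have h₂ := hD.conflation_shear hR (BinaryBiproduct.isBilimit Y I) h' s
  rw [ht] at h₁
  rw [hs] at h₂
  have e : (f ≫ P.inl + i ≫ P.inr) ≫ (BinaryBiproduct.bicone P.pt J).inl +
      j ≫ (BinaryBiproduct.bicone P.pt J).inr =
      ((f ≫ Q.inl + j ≫ Q.inr) ≫ R.inl + i ≫ R.inr : A ⟶ P.pt ⊞ J) := by
    simp [R]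
    abel
  rw [e] at h₁
  obtain ⟨c, -⟩ := hD.exists_cone_iso h₁ h₂
  -- `Y` is a summand of `Y ⊕ I ≅ X ⊕ J`, which is in `N`.
  exact ⟨Y, p, h', hsum _ (BinaryBiproduct.isBilimit Y I)
    (hN.iso c (hN.sum _ (BinaryBiproduct.isBilimit X J) hX (hI _ hJ)))⟩

omit hN in
/-- A morphism `f` is a weak equivalence if and only if it can be completed by a morphism to an
injective object to an inflation with cone in `N`. -/
lemma weq_of_inflWithCone_column {A B I : C} {f : A ⟶ B} {i : A ⟶ I} (hI : D.injectives I)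
    {P : BinaryBicone B I} (hP : P.IsBilimit)
    (h : D.inflWithCone N (f ≫ P.inl + i ≫ P.inr)) : D.weq N f :=
  ⟨P.pt, f ≫ P.inl + i ≫ P.inr, P.fst, h,
    ⟨I, P.inr, hD.conflation_split (swapBicone P) (swapBiconeIsBilimit hP), hI⟩, by simp⟩

omit hN in
/-- A deflation with injective cocone is the projection of a direct sum. -/
lemma exists_bicone_of_deflWithCocone {A B : C} {q : A ⟶ B}
    (hq : D.deflWithCocone D.injectives q) :
    ∃ (I : C) (P : BinaryBicone B I), D.injectives I ∧ Nonempty P.IsBilimit ∧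
      ∃ e : P.pt ≅ A, e.hom ≫ q = P.fst := by
  obtain ⟨I, a, ⟨δ, h⟩, hI⟩ := hq
  have := hD.hasBinaryBiproducts
  -- The class lies in `E(B, I) = 0`, so the conflation splits.
  obtain rfl : δ = 0 := hI _ _
  obtain ⟨b, hb₁, hb₂⟩ := (hD.tri_iff _ _ (hD.tri_zero _
    (swapBiconeIsBilimit (BinaryBiproduct.isBilimit B I)))).1 h
  exact ⟨I, _, hI, ⟨BinaryBiproduct.isBilimit B I⟩, b, hb₂⟩

omit hN in
lemma exists_inflWithCone_column_of_weq {A B : C} {f : A ⟶ B} (hf : D.weq N f) :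
    ∃ (I : C) (i : A ⟶ I) (P : BinaryBicone B I), D.injectives I ∧ Nonempty P.IsBilimit ∧
      D.inflWithCone N (f ≫ P.inl + i ≫ P.inr) := by
  obtain ⟨X, k, q, hk, hq, rfl⟩ := hf
  obtain ⟨I, P, hI, ⟨hP⟩, e, he⟩ := hD.exists_bicone_of_deflWithCocone hq
  refine ⟨I, k ≫ e.inv ≫ P.snd, P, hI, ⟨hP⟩, ?_⟩
  have := hD.inflWithCone_postcomp_iso e.symm hk
  convert this using 1
  have hq' : q = e.inv ≫ P.fst := by rw [← he]; simp
  rw [hq']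
  simp only [Category.assoc, Iso.symm_hom, ← Preadditive.comp_add, IsBilimit.binary_total hP,
    Category.comp_id]

omit hN in
lemma weq_of_inflWithCone {A B : C} {f : A ⟶ B} (hf : D.inflWithCone N f) : D.weq N f := by
  obtain ⟨O, hO⟩ := hD.exists_isZero
  have h : D.inflWithCone N (f ≫ (zeroBicone B hO).inl + (0 : A ⟶ O) ≫ (zeroBicone B hO).inr) := by
    rw [zero_comp, add_zero]
    exact (Category.comp_id f).symm ▸ hf
  exact hD.weq_of_inflWithCone_column (hD.injectives_of_isZero hO) (zeroBiconeIsBilimit B hO) h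

/-- Every column of a weak equivalence and a morphism to an injective object that is an inflation
has cone in `N`. -/
lemma inflWithCone_column_of_weq (hI : D.injectives ≤ N) (hsum : IsClosedUnderSummands N)
    {A B J : C} {f : A ⟶ B} {j : A ⟶ J} (hf : D.weq N f)
    (hJ : D.injectives J) {Q : BinaryBicone B J}
    (hQ : Q.IsBilimit) (h' : D.Conflation.cofibrations (f ≫ Q.inl + j ≫ Q.inr)) :
    D.inflWithCone N (f ≫ Q.inl + j ≫ Q.inr) := by
  obtain ⟨I, i, P, hI', ⟨hP⟩, h⟩ := hD.exists_inflWithCone_column_of_weq hf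
  exact hD.inflWithCone_column_of_inflWithCone_column hN hI hsum hI' hJ hP hQ h h'

/-- Following the column `(f, i)` by `(g, j) ⊕ 1` gives the column of `f ≫ g` and `(f ≫ j, i) : A ⟶
J ⊕ I`. -/
lemma weq_comp {A B X : C} {f : A ⟶ B} {g : B ⟶ X} (hf : D.weq N f) (hg : D.weq N g) :
    D.weq N (f ≫ g) := by
  obtain ⟨I, i, P, hI, ⟨hP⟩, h⟩ := hD.exists_inflWithCone_column_of_weq hf
  obtain ⟨J, j, Q, hJ, ⟨hQ⟩, h'⟩ := hD.exists_inflWithCone_column_of_weq hg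
  have := hD.hasBinaryBiproducts
  let R : BinaryBicone X (J ⊞ I) :=
    { pt := Q.pt ⊞ I
      fst := biprod.fst ≫ Q.fst
      snd := biprod.map Q.snd (𝟙 I)
      inl := Q.inl ≫ biprod.inl
      inr := biprod.map Q.inr (𝟙 I) }
  have hR : R.IsBilimit := isBinaryBilimitOfTotal _ <| by
    simp only [R]
    apply biprod.hom_ext'
    · simp [bicone_total_comp hQ]
    · simp
  have key := hD.inflWithCone_comp hN h (hD.inflWithCone_sum hN hP
    (BinaryBiproduct.isBilimit Q.pt I) h' (hD.inflWithCone_id hN I))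
  refine hD.weq_of_inflWithCone_column (i := biprod.lift (f ≫ j) i)
    (hD.injectives_sum _ (BinaryBiproduct.isBilimit J I) hJ hI) hR ?_
  convert key using 1
  simp only [R, bisum]
  apply biprod.hom_ext <;> simp

lemma weq_bisum {A B A' B' : C} {f : A ⟶ B} {f' : A' ⟶ B'} {P : BinaryBicone A A'}
    {Q : BinaryBicone B B'} (hP : P.IsBilimit) (hQ : Q.IsBilimit) (hf : D.weq N f)
    (hf' : D.weq N f') : D.weq N (bisum P Q f f') := by
  obtain ⟨I, i, R, hI, ⟨hR⟩, h⟩ := hD.exists_inflWithCone_column_of_weq hf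
  obtain ⟨J, j, S, hJ, ⟨hS⟩, h'⟩ := hD.exists_inflWithCone_column_of_weq hf'
  have := hD.hasBinaryBiproducts
  let T : BinaryBicone Q.pt (I ⊞ J) :=
    { pt := R.pt ⊞ S.pt
      fst := biprod.fst ≫ R.fst ≫ Q.inl + biprod.snd ≫ S.fst ≫ Q.inr
      snd := biprod.map R.snd S.snd
      inl := Q.fst ≫ R.inl ≫ biprod.inl + Q.snd ≫ S.inl ≫ biprod.inr
      inr := biprod.map R.inr S.inr
      inl_fst := by rw [← IsBilimit.binary_total hQ]; simp }
  have hT : T.IsBilimit := isBinaryBilimitOfTotal _ <| by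
    simp only [T]
    apply biprod.hom_ext'
    · simp [bicone_total_comp hR]
    · simp [bicone_total_comp hS]
  have key := hD.inflWithCone_sum hN hP (BinaryBiproduct.isBilimit R.pt S.pt) h h'
  refine hD.weq_of_inflWithCone_column (i := bisum P (BinaryBiproduct.bicone I J) i j)
    (hD.injectives_sum _ (BinaryBiproduct.isBilimit I J) hI hJ) hT ?_
  convert key using 1
  simp only [T, bisum]
  apply biprod.hom_ext <;> simp

variable (hE : D.HasEnoughInjectives) (hI : D.injectives ≤ N) (hsum : IsClosedUnderSummands N)
  (hcone : D.IsClosedUnderCones N)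

include hE hI hsum hcone

/-- The pushout `Y` of `f₁` and `x` receives `B₁` with cone that of `x`, and `A₂` with cone `X₁`.
The first fact shows that the induced `Y ⟶ B₂`, completed to a column, has cone in `N`; the second
turns this column into an inflation out of `X₁` with the same cone. -/
lemma exists_weq_of_inflWithCone {A₁ B₁ X₁ A₂ B₂ X₂ : C} {f₁ : A₁ ⟶ B₁} {g₁ : B₁ ⟶ X₁}
    {f₂ : A₂ ⟶ B₂} {g₂ : B₂ ⟶ X₂} (h₁ : D.Conflation f₁ g₁) (h₂ : D.Conflation f₂ g₂)
    {x : A₁ ⟶ A₂} {y : B₁ ⟶ B₂} (hx : D.inflWithCone N x) (hy : D.weq N y)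
    (hxy : f₁ ≫ y = x ≫ f₂) : ∃ q : X₁ ⟶ X₂, D.weq N q ∧ g₁ ≫ q = y ≫ g₂ := by
  have := hD.hasBinaryBiproducts
  have hP := BinaryBiproduct.isBilimit B₁ A₂
  obtain ⟨Y, p, e, hp, hde, hbe⟩ := hD.exists_pushout h₁ x hP
  obtain ⟨X, r, hxr, hX⟩ := hx
  -- The sign change on `A₁` exchanges the roles of `f₁` and `x` in the pushout.
  have hp' : D.Conflation (x ≫ biprod.inr - f₁ ≫ biprod.inl : A₁ ⟶ B₁ ⊞ A₂) p :=
    hD.conflation_of_iso ⟨-𝟙 A₁, -𝟙 A₁, by simp, by simp⟩ (Iso.refl (B₁ ⊞ A₂)) (Iso.refl Y)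
      (by simp [sub_eq_add_neg, add_comm]) (by simp) hp
  obtain ⟨e', hbe', -⟩ := hD.conflation_of_pushout hxr f₁ (swapBiconeIsBilimit hP) hp'
  change D.Conflation (biprod.inl ≫ p) e' at hbe'
  change D.Conflation (biprod.inr ≫ p) e at hde
  change biprod.inl ≫ p ≫ e = g₁ at hbe
  obtain ⟨a, ha⟩ := hD.conflation_desc hp (biprod.desc y f₂) (by simp [hxy])
  have ha₁ : biprod.inl ≫ p ≫ a = y := by rw [ha]; simp
  have ha₂ : biprod.inr ≫ p ≫ a = f₂ := by rw [ha]; simp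
  -- An inflation `l` into an injective makes the column `(a, l)` an inflation, whatever `a` is.
  obtain ⟨L, S, l, s, hL, hls⟩ := hE Y
  have hQ := BinaryBiproduct.isBilimit B₂ L
  have hal : D.Conflation.cofibrations (a ≫ biprod.inl + l ≫ biprod.inr : Y ⟶ B₂ ⊞ L) := by
    have := hD.inflation_column ⟨_, _, hls⟩ a (swapBiconeIsBilimit hQ)
    rw [add_comm]
    exact this
  have hK : D.inflWithCone N (a ≫ biprod.inl + l ≫ biprod.inr : Y ⟶ B₂ ⊞ L) := by
    refine hD.inflWithCone_of_comp hN hcone ⟨_, _, hbe', hX⟩ hal ?_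
    -- Restricted to `B₁`, this is a column of the weak equivalence `y`, hence has cone in `N`.
    have e₀ : (biprod.inl ≫ p) ≫ (a ≫ biprod.inl + l ≫ biprod.inr : Y ⟶ B₂ ⊞ L) =
        y ≫ (BinaryBiproduct.bicone B₂ L).inl +
          (biprod.inl ≫ p ≫ l) ≫ (BinaryBiproduct.bicone B₂ L).inr := by
      simp [reassoc_of% ha₁]
    rw [e₀]
    apply hD.inflWithCone_column_of_weq hN hI hsum hy hL hQ
    rw [← e₀]
    exact hD.inflation_comp_cofibrations ⟨_, _, hbe'⟩ hal
  obtain ⟨Q, r, hQr, hQN⟩ := hK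
  -- Restricted to `A₂`, the column is `(f₂, f₂ ≫ t)` since `L` is injective, so its cone `W` is `X₂
  -- ⊕ L`; and `d : X₁ ⟶ W` has cone in `N`.
  obtain ⟨W, k, d, e'', hk, hd, hdk, -⟩ := hD.inflation_comp hde hQr
  obtain ⟨t, ht⟩ := hD.exists_desc_of_injective h₂ hL (biprod.inr ≫ p ≫ l)
  have hsh := hD.conflation_shear hQ (BinaryBiproduct.isBilimit X₂ L) h₂ t
  have e₁ : (biprod.inr ≫ p) ≫ (a ≫ biprod.inl + l ≫ biprod.inr : Y ⟶ B₂ ⊞ L) =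
      f₂ ≫ (BinaryBiproduct.bicone B₂ L).inl + (f₂ ≫ t) ≫ (BinaryBiproduct.bicone B₂ L).inr := by
    simp [reassoc_of% ha₂, ht]
  rw [e₁] at hk
  obtain ⟨φ, hφ⟩ := hD.exists_cone_iso hk hsh
  refine ⟨d ≫ φ.hom ≫ biprod.fst, ?_, ?_⟩
  · refine hD.weq_of_inflWithCone_column (i := d ≫ φ.hom ≫ biprod.snd) hL
      (BinaryBiproduct.isBilimit X₂ L) ?_
    have := hD.inflWithCone_postcomp_iso φ ⟨_, _, hd, hQN⟩
    convert this using 1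
    apply biprod.hom_ext <;> simp
  · have := congrArg (fun z => biprod.inl ≫ p ≫ z ≫ φ.hom ≫ biprod.fst) hdk
    simp only [Category.assoc, reassoc_of% hbe] at this
    rw [this, reassoc_of% hφ]
    simp [reassoc_of% ha₁]

/-- In a morphism of conflations whose first two components are weak equivalences, the third one
can be chosen to be a weak equivalence. -/
lemma exists_weq {A₁ B₁ X₁ A₂ B₂ X₂ : C} {f₁ : A₁ ⟶ B₁} {g₁ : B₁ ⟶ X₁}
    {f₂ : A₂ ⟶ B₂} {g₂ : B₂ ⟶ X₂} (h₁ : D.Conflation f₁ g₁) (h₂ : D.Conflation f₂ g₂)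
    {x : A₁ ⟶ A₂} {y : B₁ ⟶ B₂} (hx : D.weq N x) (hy : D.weq N y)
    (hxy : f₁ ≫ y = x ≫ f₂) : ∃ q : X₁ ⟶ X₂, D.weq N q ∧ g₁ ≫ q = y ≫ g₂ := by
  have := hD.hasBinaryBiproducts
  -- Adding `J` to both `A₂` and `B₂` keeps the cone `X₂`, while the columns `(x, f₁ ≫ j)` and `(y,
  -- j)` become inflations with cone in `N`.
  obtain ⟨J, S, j, s, hJ, hjs⟩ := hE B₁
  have hP := BinaryBiproduct.isBilimit A₂ J
  have hQ := BinaryBiproduct.isBilimit B₂ J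
  have hx' := hD.inflWithCone_column_of_weq hN hI hsum (j := f₁ ≫ j) hx hJ hP (by
    rw [add_comm]
    exact hD.inflation_column (hD.inflation_comp_cofibrations ⟨_, _, h₁⟩ ⟨_, _, hjs⟩) x
      (swapBiconeIsBilimit hP))
  have hy' := hD.inflWithCone_column_of_weq hN hI hsum (j := j) hy hJ hQ (by
    rw [add_comm]
    exact hD.inflation_column ⟨_, _, hjs⟩ y (swapBiconeIsBilimit hQ))
  obtain ⟨q, hq, hq'⟩ := hD.exists_weq_of_inflWithCone hN hE hI hsum hcone h₁
    (hD.conflation_sum_id_left hP hQ h₂) hx' (hD.weq_of_inflWithCone hy')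
    (by simp [bisum, reassoc_of% hxy])
  exact ⟨q, hq, by simpa using hq'⟩

theorem isWeakWaldhausen_weq : IsWeakWaldhausen D.Conflation (D.weq N) where
  __ := hD.isWeakWaldhausen_isomorphisms
  ww0_comp := ⟨fun _ _ hf hg => hD.weq_comp hN hf hg⟩
  ww0_iso := fun A B f (hf : IsIso f) => hD.weq_of_inflWithCone <| by
    simpa using hD.inflWithCone_postcomp_iso (asIso f) (hD.inflWithCone_id hN A)
  ww1 := fun f₁ c₁ f₂ c₂ x y z P₁ P₂ p₁ p₂ hP₁ hP₂ _ _ hx hy hz h₁ h₂ hp₁ hp₂ =>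
    hD.exists_weq hN hE hI hsum hcone hp₁ hp₂ hx (hD.weq_bisum hN hP₁ hP₂ hy hz)
      (by simp [bisum, reassoc_of% h₁, reassoc_of% h₂, sub_eq_add_neg])

end ExtriData.IsExtriangulated

/-! ### Restriction to `N`, acyclic objects and extension of exact functors -/

namespace ExtriData

variable {C : Type u} [Category.{v} C] [Preadditive C] {D : ExtriData.{u, v, w} C}

/-- The image of a bicone of the full subcategory `N`. -/
@[simps]
def mapBicone {N : ObjectProperty C} {A B : N.FullSubcategory} (P : BinaryBicone A B) :
    BinaryBicone A.obj B.obj where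
  pt := P.pt.obj
  fst := P.fst.hom
  snd := P.snd.hom
  inl := P.inl.hom
  inr := P.inr.hom
  inl_fst := N.ι.congr_map P.inl_fst
  inl_snd := N.ι.congr_map P.inl_snd
  inr_fst := N.ι.congr_map P.inr_fst
  inr_snd := N.ι.congr_map P.inr_snd

def mapBiconeIsBilimit {N : ObjectProperty C} {A B : N.FullSubcategory} {P : BinaryBicone A B}
    (hP : P.IsBilimit) : (mapBicone P).IsBilimit :=
  isBinaryBilimitOfTotal _ (N.ι.congr_map (IsBilimit.binary_total hP))

lemma IsExtriangulated.hasFiniteBiproducts_fullSubcategory (hD : D.IsExtriangulated)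
    {N : ObjectProperty C} (hN : D.IsExtensionClosed N) :
    HasFiniteBiproducts N.FullSubcategory := by
  obtain ⟨O, hO⟩ := hD.exists_isZero
  have := hD.hasBinaryBiproducts
  have : HasZeroObject N.FullSubcategory :=
    ⟨⟨O, hN.zero O hO⟩, (IsZero.iff_id_eq_zero _).2 (N.hom_ext (hO.eq_of_src _ _))⟩
  have : HasBinaryBiproducts N.FullSubcategory := ⟨fun A B => by
    refine hasBinaryBiproduct_of_total
      { pt := ⟨A.obj ⊞ B.obj, hN.sum _ (BinaryBiproduct.isBilimit A.obj B.obj)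
          A.property B.property⟩
        fst := ObjectProperty.homMk biprod.fst
        snd := ObjectProperty.homMk biprod.snd
        inl := ObjectProperty.homMk biprod.inl
        inr := ObjectProperty.homMk biprod.inr
        inl_fst := N.hom_ext biprod.inl_fst
        inl_snd := N.hom_ext biprod.inl_snd
        inr_fst := N.hom_ext biprod.inr_fst
        inr_snd := N.hom_ext biprod.inr_snd } (N.hom_ext biprod.total)⟩
  have : HasFiniteProducts N.FullSubcategory := hasFiniteProducts_of_has_binary_and_terminal
  exact HasFiniteBiproducts.of_hasFiniteProducts

/-- An extension-closed subcategory of an extriangulated category is extriangulated. -/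
theorem IsExtriangulated.restrict (hD : D.IsExtriangulated) {N : ObjectProperty C}
    (hN : D.IsExtensionClosed N) : (D.restrict N).IsExtriangulated where
  additive := hD.hasFiniteBiproducts_fullSubcategory hN
  additive_left := ⟨fun {X Y f g} => by
    have := hD.additive_left
    ext A x
    exact congrArg (fun t => (t.app A.obj).hom x)
      (D.E.map_add (f := f.unop.hom.op) (g := g.unop.hom.op))⟩
  additive_right X := ⟨fun {A B f g} => by
    have := hD.additive_right (op X.unop.obj)
    exact (D.E.obj (op X.unop.obj)).map_add⟩
  exists_tri {X A} δ := by
    obtain ⟨B, f, g, h⟩ := hD.exists_tri (X := X.obj) (A := A.obj) δ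
    exact ⟨⟨B, hN.ext f g ⟨δ, h⟩ A.property X.property⟩, ObjectProperty.homMk f,
      ObjectProperty.homMk g, h⟩
  tri_iff {A B B' X δ f g} f' g' h := by
    refine (hD.tri_iff f'.hom g'.hom h).trans ⟨?_, ?_⟩
    · rintro ⟨b, h₁, h₂⟩
      exact ⟨N.isoMk b, N.hom_ext h₁, N.hom_ext h₂⟩
    · rintro ⟨b, h₁, h₂⟩
      exact ⟨N.ι.mapIso b, N.ι.congr_map h₁, N.ι.congr_map h₂⟩
  realize {A B X A' B' X' f g δ f' g' δ'} a c h h' hδ := by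
    obtain ⟨b, h₁, h₂⟩ := hD.realize a.hom c.hom h h' hδ
    exact ⟨ObjectProperty.homMk b, N.hom_ext h₁, N.hom_ext h₂⟩
  tri_zero P hP := hD.tri_zero (mapBicone P) (mapBiconeIsBilimit hP)
  tri_sum P Q R hP hQ hR h h' := hD.tri_sum (mapBicone P) (mapBicone Q) (mapBicone R)
    (mapBiconeIsBilimit hP) (mapBiconeIsBilimit hQ) (mapBiconeIsBilimit hR) h h'
  et3 {A B X A' B' X' f g δ f' g' δ'} a b h h' hδ := by
    obtain ⟨c, h₁, h₂⟩ := hD.et3 a.hom b.hom h h' (N.ι.congr_map hδ)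
    exact ⟨ObjectProperty.homMk c, N.hom_ext h₁, h₂⟩
  et3_op {A B X A' B' X' f g δ f' g' δ'} b c h h' hδ := by
    obtain ⟨a, h₁, h₂⟩ := hD.et3_op b.hom c.hom h h' (N.ι.congr_map hδ)
    exact ⟨ObjectProperty.homMk a, N.hom_ext h₁, h₂⟩
  et4 {A B X Y Z f f' δ g g' ρ} h h' := by
    obtain ⟨W, k, d, e, δ', h₁, h₂, h₃, h₄, h₅, h₆⟩ := hD.et4 h h'
    -- The new object of (ET4) is an extension of `Z` by `X`, so it stays in `N`.
    exact ⟨⟨W, hN.ext d e ⟨_, h₂⟩ X.property Z.property⟩, ObjectProperty.homMk k,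
      ObjectProperty.homMk d, ObjectProperty.homMk e, δ', h₁, h₂, N.hom_ext h₃, N.hom_ext h₄,
      h₅, h₆⟩
  et4_op {A B X Y Z f' f δ g' g ρ} h h' := by
    obtain ⟨W, d, e, k, δ', h₁, h₂, h₃, h₄, h₅, h₆⟩ := hD.et4_op h h'
    exact ⟨⟨W, hN.ext d e ⟨_, h₂⟩ X.property Z.property⟩, ObjectProperty.homMk d,
      ObjectProperty.homMk e, ObjectProperty.homMk k, δ', h₁, h₂, N.hom_ext h₃, N.hom_ext h₄,
      h₅, h₆⟩

variable (hD : D.IsExtriangulated) {N : ObjectProperty C} (hN : D.IsExtensionClosed N)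

include hD hN

lemma IsExtriangulated.acyclic_weq (hI : D.injectives ≤ N) (hcone : D.IsClosedUnderCones N) :
    acyclic (D.weq N) = N := by
  ext X
  constructor
  -- `Y` is an extension of `Y'` by a zero object, and `X` is the cone of `I ⟶ Y` with `I`, `Y` in
  -- `N`.
  · rintro ⟨Z, hZ, i, Y, k, q, ⟨Y', g, h, hY'⟩, ⟨I, a, h', hI'⟩, -⟩
    exact hcone a q h' (hI _ hI') (hN.ext k g h (hN.zero Z hZ) hY')
  · intro hX
    obtain ⟨O, hO⟩ := hD.exists_isZero
    exact ⟨O, hO, 0, hD.weq_of_inflWithCone ⟨X, 𝟙 X, ⟨_, hD.tri_id_right X hO⟩, hX⟩⟩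

lemma IsExtriangulated.isWeakWaldhausen_restrict : IsWeakWaldhausen (D.Conflation.restrict N)
    ((MorphismProperty.isomorphisms C).inverseImage N.ι) := by
  have h₁ : (MorphismProperty.isomorphisms C).inverseImage N.ι =
      MorphismProperty.isomorphisms N.FullSubcategory := by
    ext X Y f
    exact N.isIso_hom_iff f
  rw [h₁]
  exact (hD.restrict hN).isWeakWaldhausen_isomorphisms

omit hN in
/-- An exact functor that sends `N` to acyclic objects sends weak equivalences to weak
equivalences. -/
lemma IsExtriangulated.isWaldExact_weq (hI : D.injectives ≤ N) {C' : Type u'} [Category.{v'} C']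
    [Preadditive C'] {Seq' : SeqClass C'} {W' : MorphismProperty C'}
    (hW : IsWeakWaldhausen Seq' W') (h23 : W'.HasTwoOutOfThreeProperty)
    (hext : ExtensionAxiom Seq' W') {F : C ⥤ C'}
    (hF : IsWaldExact F D.Conflation (MorphismProperty.isomorphisms C) Seq' W')
    (hFN : ∀ X, N X → acyclic W' (F.obj X)) : IsWaldExact F D.Conflation (D.weq N) Seq' W' where
  additive := hF.additive
  map_seq := hF.map_seq
  map_weq := by
    have hK : ∀ {A B : C} (k : A ⟶ B), D.inflWithCone N k → W' (F.map k) := by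
      rintro A B k ⟨X, g, h, hX⟩
      obtain ⟨Z, hZ, i, hi⟩ := hFN X hX
      have h' := hF.map_seq k g h
      have hs : Seq' (𝟙 (F.obj A)) (0 : F.obj A ⟶ Z) :=
        hW.wc1_split (ShortComplex.mk (𝟙 (F.obj A)) (0 : F.obj A ⟶ Z) (by simp))
          ⟨{ r := 𝟙 _, s := 0, f_r := by simp, s_g := hZ.eq_of_src _ _, id := by simp }⟩
      -- The extension axiom compares `F A ⟶ F A ⟶ 0` with the image conflation; the outer
      -- components are `𝟙` and `0 ⟶ F X`.
      exact hext (𝟙 _) (F.map k) i hs h' (by simp)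
        (by rw [zero_comp, (hW.wc1_weakCokernel h').1])
        (hW.ww0_iso _ (inferInstanceAs (IsIso (𝟙 (F.obj A))))) hi
    rintro A B _ ⟨X, k, q, hk, hq, rfl⟩
    obtain ⟨I, P, hI', ⟨hP⟩, e, he⟩ := hD.exists_bicone_of_deflWithCocone hq
    -- A section of `q` is an inflation with cone `I`, which is in `N`; 2-out-of-3 then gives `F.map
    -- q`.
    have hs := hK _ (hD.inflWithCone_postcomp_iso e
      (⟨I, P.snd, hD.conflation_split P hP, hI _ hI'⟩ : D.inflWithCone N P.inl))
    rw [F.map_comp]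
    refine hW.ww0_comp.comp_mem _ _ (hK k hk) (h23.of_precomp _ _ hs ?_)
    rw [← F.map_comp, Category.assoc, he, P.inl_fst, F.map_id]
    exact hW.ww0_iso _ (inferInstanceAs (IsIso (𝟙 (F.obj B))))

end ExtriData

/-! ### Exactness on Grothendieck groups -/

section K0

variable {C : Type u} [Category.{v} C] [Preadditive C]

/-- The class of an object. -/
def K0Wald.cls (Seq : SeqClass C) (W : MorphismProperty C) (A : C) : K0Wald Seq W :=
  QuotientAddGroup.mk (K0Split.cls A)

lemma K0Wald.cls_eq_of_weq {Seq : SeqClass C} {W : MorphismProperty C} {A B : C} (f : A ⟶ B)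
    (hf : W f) : K0Wald.cls Seq W A = K0Wald.cls Seq W B := by
  rw [← sub_eq_zero]
  exact (QuotientAddGroup.eq_zero_iff _).2 (AddSubgroup.subset_closure (Or.inl ⟨A, B, f, hf, rfl⟩))

lemma K0Wald.cls_eq_add {Seq : SeqClass C} {W : MorphismProperty C} {A B X : C} {f : A ⟶ B}
    {g : B ⟶ X} (h : Seq f g) :
    K0Wald.cls Seq W B = K0Wald.cls Seq W A + K0Wald.cls Seq W X := by
  rw [← sub_eq_zero]
  exact (QuotientAddGroup.eq_zero_iff _).2
    (AddSubgroup.subset_closure (Or.inr ⟨A, B, X, f, g, h, rfl⟩))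

lemma K0Wald.cls_zero {Seq : SeqClass C} {W : MorphismProperty C} {Z : C} (hZ : IsZero Z) :
    K0Wald.cls Seq W Z = 0 := by
  rw [K0Wald.cls, K0Split.cls_zero hZ]
  rfl

lemma K0Split.hom_ext {G : Type*} [AddGroup G] {φ ψ : K0Split C →+ G}
    (h : ∀ A, φ (K0Split.cls A) = ψ (K0Split.cls A)) : φ = ψ :=
  QuotientAddGroup.addMonoidHom_ext _ <| AddMonoidHom.ext fun x =>
    FreeAbelianGroup.induction_on x (by simp) h (fun A hA => by rw [map_neg, map_neg, hA])
      fun x y hx hy => by rw [map_add, map_add, hx, hy]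

lemma K0Wald.hom_ext {Seq : SeqClass C} {W : MorphismProperty C} {G : Type*} [AddGroup G]
    {φ ψ : K0Wald Seq W →+ G} (h : ∀ A, φ (K0Wald.cls Seq W A) = ψ (K0Wald.cls Seq W A)) :
    φ = ψ :=
  QuotientAddGroup.addMonoidHom_ext _ (K0Split.hom_ext h)

variable {Seq : SeqClass C} {V W : MorphismProperty C} (h : IsWaldExact (𝟭 C) Seq V Seq W)

lemma K0Wald.map_id_surjective : Function.Surjective (K0Wald.map h) := by
  have e : (K0Wald.map h).comp (QuotientAddGroup.mk' (waldRelations Seq V)) =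
      QuotientAddGroup.mk' (waldRelations Seq W) := K0Split.hom_ext fun A => rfl
  intro y
  obtain ⟨x, rfl⟩ := QuotientAddGroup.mk'_surjective _ y
  exact ⟨QuotientAddGroup.mk' _ x, DFunLike.congr_fun e x⟩

/-- The kernel of `K₀(C, Seq, V) → K₀(C, Seq, W)` is generated by the `[A] - [B]` for
weak equivalences `A ⟶ B`. -/
lemma K0Wald.ker_map_id_le (R : AddSubgroup (K0Wald Seq V))
    (hR : ∀ {A B : C} (f : A ⟶ B), W f → K0Wald.cls Seq V A - K0Wald.cls Seq V B ∈ R) :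
    (K0Wald.map h).ker ≤ R := by
  -- Modulo `R` the relations of `W` already hold, so the projection onto the quotient by `R`
  -- factors through `K0Wald.map h`.
  let φ : K0Wald Seq W →+ K0Wald Seq V ⧸ R := QuotientAddGroup.lift _
    ((QuotientAddGroup.mk' R).comp (QuotientAddGroup.mk' (waldRelations Seq V))) (by
      rw [waldRelations, AddSubgroup.closure_le]
      rintro _ (⟨A, B, f, hf, rfl⟩ | ⟨A, B, X, f, g, hfg, rfl⟩)
      · exact (QuotientAddGroup.eq_zero_iff _).2 (hR f hf)
      · have : QuotientAddGroup.mk' (waldRelations Seq V)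
            (K0Split.cls B - (K0Split.cls A + K0Split.cls X)) = 0 :=
          sub_eq_zero.2 (K0Wald.cls_eq_add hfg)
        change QuotientAddGroup.mk' R (QuotientAddGroup.mk' (waldRelations Seq V) _) = 0
        rw [this, map_zero])
  have hφ : φ.comp (K0Wald.map h) = QuotientAddGroup.mk' R :=
    K0Wald.hom_ext fun A => rfl
  intro y hy
  rw [← QuotientAddGroup.eq_zero_iff]
  have := DFunLike.congr_fun hφ y
  rw [AddMonoidHom.comp_apply, (AddMonoidHom.mem_ker).1 hy, map_zero] at this
  exact this.symm

/-- The classes of objects of `N` generate the kernel. -/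
lemma ExtriData.ker_map_weq_le {D : ExtriData.{u, v, w} C} {N : ObjectProperty C}
    (hI : D.injectives ≤ N) (h : IsWaldExact (𝟭 C) D.Conflation V D.Conflation (D.weq N))
    (R : AddSubgroup (K0Wald D.Conflation V))
    (hR : ∀ X, N X → K0Wald.cls D.Conflation V X ∈ R) : (K0Wald.map h).ker ≤ R := by
  refine K0Wald.ker_map_id_le h R ?_
  rintro A B _ ⟨Y, k, q, ⟨X, g, hk, hX⟩, ⟨I, a, hq, hI'⟩, rfl⟩
  have h₁ := K0Wald.cls_eq_add (W := V) hk
  have h₂ := K0Wald.cls_eq_add (W := V) hq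
  -- Both sides of `[A] + [X] = [I] + [B]` compute `[Y]`.
  have e : K0Wald.cls D.Conflation V A - K0Wald.cls D.Conflation V B =
      K0Wald.cls D.Conflation V I - K0Wald.cls D.Conflation V X := by
    rw [sub_eq_sub_iff_add_eq_add, ← h₁, h₂]
  rw [e]
  exact R.sub_mem (hR I (hI _ hI')) (hR X hX)

lemma K0Wald.cls_of_acyclic {X : C} (hX : acyclic W X) : K0Wald.cls Seq W X = 0 := by
  obtain ⟨Z, hZ, i, hi⟩ := hX
  rw [← K0Wald.cls_eq_of_weq i hi, K0Wald.cls_zero hZ]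

end K0

theorem mainTheorem6 {C : Type u} [Category.{v} C] [Preadditive C] [HasZeroObject C]
    (D : ExtriData.{u, v, w} C) (hD : D.IsExtriangulated)
    (hC : IsWeaklyIdempotentComplete C) (hE : D.HasEnoughInjectives)
    (N : ObjectProperty C) (hI : D.injectives ≤ N) (hext : D.IsExtensionClosed N)
    (hsum : IsClosedUnderSummands N) (hcone : D.IsClosedUnderCones N) :
    IsWeakWaldhausen D.Conflation (D.weq N) ∧
    acyclic (D.weq N) = N ∧
    (D.restrict N).IsExtriangulated ∧
    ∃ h : IsLocalizationSequence.{u, v, u', v'} D.Conflation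
        (MorphismProperty.isomorphisms C) (D.weq N),
      (Function.Exact (K0Wald.map h.exact_inc) (K0Wald.map h.exact_id) ∧
        Function.Surjective (K0Wald.map h.exact_id)) ∧
      (Function.Exact (K0Extri.inc D N)
          ((K0Wald.map h.exact_id).comp (K0Extri.equivWald D).toAddMonoidHom) ∧
        Function.Surjective
          ((K0Wald.map h.exact_id).comp (K0Extri.equivWald D).toAddMonoidHom)) := by
  have hW := hD.isWeakWaldhausen_weq hext hE hI hsum hcone
  have hac := hD.acyclic_weq hext hI hcone
  have hloc : IsLocalizationSequence.{u, v, u', v'} D.Conflation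
      (MorphismProperty.isomorphisms C) (D.weq N) :=
    { wald_left := hac.symm ▸ hD.isWeakWaldhausen_restrict hext
      wald_middle := hD.isWeakWaldhausen_isomorphisms
      wald_right := hW
      exact_inc := ⟨inferInstance, fun _ _ h => h, fun _ h => h⟩
      exact_id := ⟨inferInstance, fun _ _ h => h, fun f hf => hW.ww0_iso f hf⟩
      extend := fun C' _ _ Seq' W' hW' h23 hex F hF hFN =>
        hD.isWaldExact_weq hI hW' h23 hex hF fun X hX => hFN X (hac.symm ▸ hX) }
  have hsurj := K0Wald.map_id_surjective hloc.exact_id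
  refine ⟨hW, hac, hD.restrict hext, hloc, ⟨?_, hsurj⟩, ?_,
    hsurj.comp (K0Extri.equivWald D).surjective⟩
  · rw [AddMonoidHom.exact_iff]
    apply le_antisymm
    · refine ExtriData.ker_map_weq_le hI hloc.exact_id _ fun X hX => ?_
      exact ⟨K0Wald.cls _ _ ⟨X, hac.symm ▸ hX⟩, rfl⟩
    · rintro _ ⟨x, rfl⟩
      have e : (K0Wald.map hloc.exact_id).comp (K0Wald.map hloc.exact_inc) = 0 :=
        K0Wald.hom_ext fun A => K0Wald.cls_of_acyclic (X := A.obj) A.property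
      exact DFunLike.congr_fun e x
  · rw [AddMonoidHom.exact_iff]
    apply le_antisymm
    · intro y hy
      -- The kernel bound lives in `K0Wald`, so the image of `K0Extri.inc` is transported along the
      -- identification and the result pulled back by injectivity.
      obtain ⟨z, hz, hzy⟩ := ExtriData.ker_map_weq_le hI hloc.exact_id
        ((K0Extri.inc D N).range.map (K0Extri.equivWald D).toAddMonoidHom)
        (fun X hX => ⟨QuotientAddGroup.mk (K0Split.cls X),
          ⟨QuotientAddGroup.mk (K0Split.cls ⟨X, hX⟩), rfl⟩, rfl⟩) hy
      rwa [← (K0Extri.equivWald D).injective hzy]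
    · rintro _ ⟨x, rfl⟩
      have e : ((K0Wald.map hloc.exact_id).comp (K0Extri.equivWald D).toAddMonoidHom).comp
          (K0Extri.inc D N) = 0 :=
        QuotientAddGroup.addMonoidHom_ext _ (K0Split.hom_ext fun A =>
          K0Wald.cls_of_acyclic (X := A.obj) (hac.symm ▸ A.property))
      exact DFunLike.congr_fun e x
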